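/- For $d\ge 0$ let $S^{d-1}\subset\mathbb R^d$ be the Euclidean unit sphere. A configuration $w=(w_1,\dots,w_5)$ of five pairwise distinct points of $S^{d-1}$ is called critical (for the logarithmic Fekete problem) if there are $\lambda_1,\dots,\lambda_5\in\mathbb R$ such that the Lagrangian $$L(w,\lambda)=-\sum_{i<j}\log\|w_i-w_j\|^2+\sum_i\lambda_i(\|w_i\|^2-1)$$ has zero gradient with respect to $w$. Its dot product matrix is $X=(w_i^Tw_j)_{i,j}$ and its product energy is $E(w)=\prod_{i<j}\|w_i-w_j\|^2$. A critical configuration in $S^{d-1}$ is called optimal if its product energy is maximal among all critical configurations of five points in $S^{d-1}$. Consider the following four real symmetric $5\times5$ matrices with ones on the diagonal: * $X_{\mathrm{simplex}}$ (4-simplex): all off-diagonal entries are $-\tfrac14$; * $X_{1:3:1}$ (triangular bipyramid): $x_{12}=-1$, $x_{34}=x_{35}=x_{45}=-\tfrac12$, all other off-diagonal entries $0$; * $X_{1:4}$ (square pyramid): $x_{1j}=-\tfrac14$ for $j\ge2$, $x_{24}=x_{35}=-\tfrac78$, $x_{23}=x_{34}=x_{45}=x_{25}=\tfrac1{16}$;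 * $X_{\mathrm{Eq}}$ (regular 5-gon, "Equator"): $x_{ij}=\tfrac{-1+\sqrt5}4$ if $i-j\equiv\pm1\pmod 5$ and $x_{ij}=\tfrac{-1-\sqrt5}4$ if $i-j\equiv\pm2\pmod5$. For a matrix $X$ let $\mathrm{Orb}(X)$ be the set of matrices $P^TXP$ with $P$ a permutation matrix. Then: 1. For every $d$, a tuple $w\in(\mathbb R^d)^5$ is a critical configuration if and only if its dot product matrix lies in the orbit of one of the four matrices above. 2. The ranks of $X_{\mathrm{simplex}},X_{1:3:1},X_{1:4},X_{\mathrm{Eq}}$ are $4,3,3,2$, and each of these matrices $X$ is the dot product matrix of a critical configuration in $S^{d-1}$ if and only if $d\ge\operatorname{rank}X$. The corresponding values of $E/2^{10}$ are $(5/4)^{10}\approx9.313$, $27/4=6.75$, $(5/4)^4(15/16)^4(15/8)^2\approx6.63$ and $3125/1024\approx3.052$. 3. The orbits of the four matrices have $1$, $10$, $15$ and $12$ elements. Let $I$ be the ideal of $\mathbb Q[x_{ij},z_{ij}:1\le i<j\le5]$ generated, with the conventions $x_{ji}=x_{ij}$, $z_{ji}=z_{ij}$, $x_{ii}=1$, by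 $$1+\sum_{k\ne j}x_{jk}\ (1\le j\le 5),\qquad z_{kj}(1-x_{kj})-1\ (k\neq j),\qquad \sum_{j\ne k}(x_{ik}-x_{ij})z_{kj}-4x_{ik}\ (k\ne i).$$ Its number of complex zeros counted with multiplicity, $\dim_{\mathbb C}\mathbb C[x_{ij},z_{ij}]/I\,\mathbb C[x_{ij},z_{ij}]$, is $38=1+10+15+12$; it has exactly $38$ distinct complex zeros $(x,z)$, and their matrices $(x_{ij})$ are exactly the elements of the four orbits. 4. A configuration of five points is optimal in $S^1$ if and only if its dot product matrix lies in $\mathrm{Orb}(X_{\mathrm{Eq}})$, optimal in $S^2$ if and only if it lies in $\mathrm{Orb}(X_{1:3:1})$, and optimal in $S^3$ if and only if it lies in $\mathrm{Orb}(X_{\mathrm{simplex}})$. These are also exactly the maximizers of $E$ over all $(w_1,\dots,w_5)\in(S^{d-1})^5$ for $d=2,3,4$ respectively. -/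

import Mathlib

noncomputable section

namespace Fekete

open scoped Matrix

/-! ### Configurations of `n` points on the unit sphere of `ℝ^d` -/

/-- Ordered `n`-tuples of vectors of `ℝ^d` (Euclidean norm on each factor). -/
abbrev Config (n d : ℕ) : Type := Fin n → EuclideanSpace ℝ (Fin d)

/-- All points lie on the unit sphere. -/
def OnSphere {n d : ℕ} (w : Config n d) : Prop := ∀ i, ‖w i‖ = 1

/-- The Lagrangian
`- ∑_{i<j} log ‖w_i - w_j‖^2 + ∑_i lam_i (‖w_i‖^2 - 1)`
of the logarithmic Fekete problem. -/
def lagrangian {n d : ℕ} (lam : Fin n → ℝ) (w : Config n d) : ℝ :=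
  -(∑ i, ∑ j ∈ Finset.Ioi i, Real.log (‖w i - w j‖ ^ 2)) + ∑ i, lam i * (‖w i‖ ^ 2 - 1)

/-- Critical configurations: pairwise distinct points of the unit sphere for which there are
multipliers such that the derivative of the Lagrangian with respect to `w` exists and is zero. -/
def IsCritical {n d : ℕ} (w : Config n d) : Prop :=
  OnSphere w ∧ Function.Injective w ∧
    ∃ lam : Fin n → ℝ, HasFDerivAt (lagrangian lam) (0 : Config n d →L[ℝ] ℝ) w

/-- The product energy `∏_{i<j} ‖w_i - w_j‖^2`. -/
def energy {n d : ℕ} (w : Config n d) : ℝ :=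
  ∏ i, ∏ j ∈ Finset.Ioi i, ‖w i - w j‖ ^ 2

/-- A critical configuration of maximal product energy among all critical configurations of the
same number of points on the same sphere. -/
def IsOptimal {n d : ℕ} (w : Config n d) : Prop :=
  IsCritical w ∧ ∀ v : Config n d, IsCritical v → energy v ≤ energy w

/-- A solution of the Fekete problem: a configuration of maximal product energy among all
configurations on the sphere. -/
def IsFeketeMaximizer {n d : ℕ} (w : Config n d) : Prop :=
  OnSphere w ∧ ∀ v : Config n d, OnSphere v → energy v ≤ energy w

/-! ### Permuted dot product matrices -/

/-- The orbit of a square matrix under simultaneous permutation of rows and columns, that is,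
under conjugation by permutation matrices. -/
def permOrbit {n : ℕ} {R : Type*} (X : Matrix (Fin n) (Fin n) R) :
    Set (Matrix (Fin n) (Fin n) R) :=
  Set.range fun s : Equiv.Perm (Fin n) => X.submatrix s s

/-! ### The four dot product matrices for five points -/

/-- The 4-simplex. -/
def simplex : Matrix (Fin 5) (Fin 5) ℝ :=
  !![1, -1/4, -1/4, -1/4, -1/4;
     -1/4, 1, -1/4, -1/4, -1/4;
     -1/4, -1/4, 1, -1/4, -1/4;
     -1/4, -1/4, -1/4, 1, -1/4;
     -1/4, -1/4, -1/4, -1/4, 1]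

/-- The triangular bipyramid 1:3:1. -/
def bipyramid : Matrix (Fin 5) (Fin 5) ℝ :=
  !![1, -1, 0, 0, 0;
     -1, 1, 0, 0, 0;
     0, 0, 1, -1/2, -1/2;
     0, 0, -1/2, 1, -1/2;
     0, 0, -1/2, -1/2, 1]

/-- The square pyramid 1:4. -/
def pyramid : Matrix (Fin 5) (Fin 5) ℝ :=
  !![1, -1/4, -1/4, -1/4, -1/4;
     -1/4, 1, 1/16, -7/8, 1/16;
     -1/4, 1/16, 1, 1/16, -7/8;
     -1/4, -7/8, 1/16, 1, 1/16;
     -1/4, 1/16, -7/8, 1/16, 1]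

/-- Cosine of `2π/5`. -/
def cosA : ℝ := (-1 + √5) / 4

/-- Cosine of `4π/5`. -/
def cosB : ℝ := (-1 - √5) / 4

/-- The regular 5-gon (Equator). -/
def pentagon : Matrix (Fin 5) (Fin 5) ℝ :=
  !![1, cosA, cosB, cosB, cosA;
     cosA, 1, cosA, cosB, cosB;
     cosB, cosA, 1, cosA, cosB;
     cosB, cosB, cosA, 1, cosA;
     cosA, cosB, cosB, cosA, 1]

/-! ### The polynomial system in the dot products -/

/-- Pairs `i < j`. -/
abbrev Pair (n : ℕ) : Type := {p : Fin n × Fin n // p.1 < p.2}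

/-- The variables: `Sum.inl p` is `x_{ij}` and `Sum.inr p` is `z_{ij}`, for `p = (i, j)`, `i < j`. -/
abbrev Vars (n : ℕ) : Type := Pair n ⊕ Pair n

/-- The symmetric matrix with constant diagonal `c` and entries `x (i, j)` for `i < j`. -/
def symMatrix {n : ℕ} {R : Type*} (c : R) (x : Pair n → R) : Matrix (Fin n) (Fin n) R :=
  Matrix.of fun i j =>
    if h : i < j then x ⟨(i, j), h⟩ else if h : j < i then x ⟨(j, i), h⟩ else c

/-- The dot product matrix of variables `x_{ij}`: symmetric, with ones on the diagonal. -/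
def xVar (n : ℕ) : Matrix (Fin n) (Fin n) (MvPolynomial (Vars n) ℚ) :=
  symMatrix 1 fun p => MvPolynomial.X (Sum.inl p)

/-- The symmetric matrix of auxiliary variables `z_{ij}`, with zeros on the diagonal. -/
def zVar (n : ℕ) : Matrix (Fin n) (Fin n) (MvPolynomial (Vars n) ℚ) :=
  symMatrix 0 fun p => MvPolynomial.X (Sum.inr p)

/-- Null center of mass: `1 + ∑_{k ≠ j} x_{jk}`. -/
def centerPoly (n : ℕ) (j : Fin n) : MvPolynomial (Vars n) ℚ :=
  1 + ∑ k ∈ Finset.univ.erase j, xVar n j k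

/-- Auxiliary variables: `z_{kj} (1 - x_{kj}) - 1`, for `k ≠ j`. -/
def auxPoly (n : ℕ) (k j : Fin n) : MvPolynomial (Vars n) ℚ :=
  zVar n k j * (1 - xVar n k j) - 1

/-- Null gradient: `∑_{j ≠ k} (x_{ik} - x_{ij}) z_{kj} - (n-1) x_{ik}`, for `k ≠ i`. -/
def gradPoly (n : ℕ) (k i : Fin n) : MvPolynomial (Vars n) ℚ :=
  (∑ j ∈ Finset.univ.erase k, (xVar n i k - xVar n i j) * zVar n k j)
    - ((n : MvPolynomial (Vars n) ℚ) - 1) * xVar n i k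

/-- The ideal of `ℚ[x_{ij}, z_{ij}]` generated by the polynomials of the system. -/
def criticalIdeal (n : ℕ) : Ideal (MvPolynomial (Vars n) ℚ) :=
  Ideal.span
    ({f | ∃ j, f = centerPoly n j} ∪ {f | ∃ k j, k ≠ j ∧ f = auxPoly n k j} ∪
      {f | ∃ k i, k ≠ i ∧ f = gradPoly n k i})

/-- The extension of the ideal to `ℂ[x_{ij}, z_{ij}]`. -/
def criticalIdealC (n : ℕ) : Ideal (MvPolynomial (Vars n) ℂ) :=
  (criticalIdeal n).map (MvPolynomial.map (algebraMap ℚ ℂ))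

/-- The complex solutions `(x, z)` of the polynomial system. -/
def solutions (n : ℕ) : Set (Vars n → ℂ) :=
  MvPolynomial.zeroLocus ℂ (criticalIdeal n)

/-- The dot product matrix of a complex point `(x, z)`. -/
def dotMatrix {n : ℕ} (p : Vars n → ℂ) : Matrix (Fin n) (Fin n) ℂ :=
  symMatrix 1 fun q => p (Sum.inl q)

/-- A real matrix regarded as a complex one. -/
def toC {n : ℕ} (X : Matrix (Fin n) (Fin n) ℝ) : Matrix (Fin n) (Fin n) ℂ :=
  X.map ((↑) : ℝ → ℂ)

end Fekete

end

noncomputable section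

namespace Fekete

open scoped Matrix

/-! ### Rank one perturbations of the simplex -/

/-! Let `x` be the dot product matrix and `z i j = 1 / (1 - x i j)` off the diagonal. Pairing the
gradient equation of `w i` with the `w k` shows that criticality is equivalent to a polynomial
system in `x` and `z` (`IsSolution`). In it the rows of `x` sum to zero, and the weighted Laplacian
with weights `z` acts on the rows of `x` as multiplication by 4. The system is solved over `ℂ`,
which yields both the real classification and the count of complex zeros.

Subtract the Laplacian with constant weights `4 / 5` from that of `z`. The resulting symmetric
matrix `N` (`defect z`) satisfies `N 1 = 0` and `x N = 0`. If `x` has rank at least 3, its kernel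
has dimension at most 2 and contains both the vector `1` and the columns of `N`. Since `1` pairs to
zero with these columns but not with itself, `N` has rank at most one. Hence `z i j = 4 / 5 * (1 - v
i * v j)`, and `x v = 0` becomes `∑_{j ≠ i} v j / (1 - v i * v j) = 0`. Clearing denominators shows
that all `v i` are roots of one cubic, so they take at most three values. The possible coincidence
patterns leave the simplex (`v = 0`), the bipyramid and the square pyramid.

If `x` has rank at most 2, the points lie on a complex circle: `x k j = (t k / t j + t j / t k) /
2`. The equations then say that `T P'' - 4 P'` vanishes at the five distinct roots `t i` of `P = ∏
(T - t i)`. Its degree is at most 3, so it is zero, `P = T ^ 5 - const`, and the configuration is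
the regular pentagon.

For multiplicities, the linearized system has only the zero solution at each of the four matrices
(`IsTangent.eq_zero`). Thus each zero `p` of the ideal `I` has maximal ideal `m ≤ I + m ^ 2`. By the
Nullstellensatz `I` is then radical, and the dimension of the quotient is the number of zeros, which
is the number of matrices in the four orbits.

For optimality, compactness gives a maximizer of the energy. The Lagrange multiplier theorem makes
it critical, and it remains to compare the energies of those types whose rank fits the dimension. -/

lemma cubic_coeffs_of_three_roots {b c d α β γ : ℂ} (hab : α ≠ β) (hac : α ≠ γ) (hbc : β ≠ γ)
    (hα : 2 * α ^ 3 + b * α ^ 2 + c * α + d = 0) (hβ : 2 * β ^ 3 + b * β ^ 2 + c * β + d = 0)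
    (hγ : 2 * γ ^ 3 + b * γ ^ 2 + c * γ + d = 0) :
    b = -2 * (α + β + γ) ∧ c = 2 * (α * β + α * γ + β * γ) ∧ d = -2 * (α * β * γ) := by
  -- Divided differences of the cubic: each division by a difference of roots lowers the degree by
  -- one and ends in Vieta's formulas.
  have h1 : 2 * (α ^ 2 + α * β + β ^ 2) + b * (α + β) + c = 0 :=
    mul_left_cancel₀ (sub_ne_zero.2 hab) (by linear_combination hα - hβ)
  have h2 : 2 * (α ^ 2 + α * γ + γ ^ 2) + b * (α + γ) + c = 0 :=
    mul_left_cancel₀ (sub_ne_zero.2 hac) (by linear_combination hα - hγ)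
  have h3 : 2 * (α + β + γ) + b = 0 :=
    mul_left_cancel₀ (sub_ne_zero.2 hbc) (by linear_combination h1 - h2)
  have hb : b = -2 * (α + β + γ) := by linear_combination h3
  subst hb
  have hc : c = 2 * (α * β + α * γ + β * γ) := by linear_combination h1
  subst hc
  exact ⟨rfl, rfl, by linear_combination hα⟩

lemma not_four_roots {b c d α β γ δ : ℂ} (hab : α ≠ β) (hac : α ≠ γ) (had : α ≠ δ)
    (hbc : β ≠ γ) (hbd : β ≠ δ) (hcd : γ ≠ δ)
    (hα : 2 * α ^ 3 + b * α ^ 2 + c * α + d = 0) (hβ : 2 * β ^ 3 + b * β ^ 2 + c * β + d = 0)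
    (hγ : 2 * γ ^ 3 + b * γ ^ 2 + c * γ + d = 0) (hδ : 2 * δ ^ 3 + b * δ ^ 2 + c * δ + d = 0) :
    False := by
  obtain ⟨rfl, rfl, rfl⟩ := cubic_coeffs_of_three_roots hab hac hbc hα hβ hγ
  have : (δ - α) * (δ - β) * (δ - γ) = 0 := by linear_combination hδ / 2
  simp [sub_eq_zero, had.symm, hbd.symm, hcd.symm] at this

/-- The vectors `v` for which `z i j = 4 / 5 * (1 - v i * v j)` solves the critical equations. -/
structure RankOneSol (v : Fin 5 → ℂ) : Prop where
  sum : ∑ i, v i = 0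
  ne : ∀ i j, i ≠ j → 1 - v i * v j ≠ 0
  eq : ∀ i, ∑ j ∈ Finset.univ.erase i, v j / (1 - v i * v j) = 0

lemma RankOneSol.comp {v : Fin 5 → ℂ} (h : RankOneSol v) (s : Equiv.Perm (Fin 5)) :
    RankOneSol (v ∘ s) where
  sum := by rw [← h.sum]; exact Equiv.sum_comp s v
  ne i j hij := h.ne _ _ (s.injective.ne hij)
  eq i := by
    rw [← h.eq (s i)]
    refine Finset.sum_equiv s ?_ ?_ <;> simp

/-- The elementary symmetric function of `v` of degree two. -/
def esymmTwo (v : Fin 5 → ℂ) : ℂ :=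
  v 0 * v 1 + v 0 * v 2 + v 0 * v 3 + v 0 * v 4 + v 1 * v 2 + v 1 * v 3 + v 1 * v 4 +
    v 2 * v 3 + v 2 * v 4 + v 3 * v 4

/-- The elementary symmetric function of `v` of degree four. -/
def esymmFour (v : Fin 5 → ℂ) : ℂ :=
  v 1 * v 2 * v 3 * v 4 + v 0 * v 2 * v 3 * v 4 + v 0 * v 1 * v 3 * v 4 +
    v 0 * v 1 * v 2 * v 4 + v 0 * v 1 * v 2 * v 3

/-- The elementary symmetric function of `v` of degree five. -/
def esymmFive (v : Fin 5 → ℂ) : ℂ := v 0 * v 1 * v 2 * v 3 * v 4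

/-- With `σ k` the elementary symmetric functions of `b, c, d, e`, clearing denominators gives `σ 1
- 2 a σ 2 + 3 a ^ 2 σ 3 - 4 a ^ 3 σ 4 = 0`. The zero sum turns the `σ k` into symmetric functions of
all five numbers, so the coefficients no longer single out `a`. -/
lemma cubic_of_rational {a b c d e : ℂ} (hs : a + b + c + d + e = 0)
    (hb : 1 - a * b ≠ 0) (hc : 1 - a * c ≠ 0) (hd : 1 - a * d ≠ 0) (he : 1 - a * e ≠ 0)
    (h : b / (1 - a * b) + c / (1 - a * c) + d / (1 - a * d) + e / (1 - a * e) = 0) :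
    2 * a ^ 3 + 4 * (a * b * c * d * e) * a ^ 2 +
      (1 + 2 * (a * b + a * c + a * d + a * e + b * c + b * d + b * e + c * d + c * e + d * e)
        - 3 * (b * c * d * e + a * c * d * e + a * b * d * e + a * b * c * e + a * b * c * d)) * a
      + 3 * (a * b * c * d * e) = 0 := by
  have h' : b * ((1 - a * c) * (1 - a * d) * (1 - a * e)) +
      c * ((1 - a * b) * (1 - a * d) * (1 - a * e)) +
      d * ((1 - a * b) * (1 - a * c) * (1 - a * e)) +
      e * ((1 - a * b) * (1 - a * c) * (1 - a * d)) = 0 := by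
    rw [div_add_div _ _ hb hc, div_add_div _ _ (mul_ne_zero hb hc) hd,
      div_add_div _ _ (mul_ne_zero (mul_ne_zero hb hc) hd) he, div_eq_zero_iff] at h
    have := h.resolve_right (mul_ne_zero (mul_ne_zero (mul_ne_zero hb hc) hd) he)
    linear_combination this
  obtain rfl : e = -(a + b + c + d) := by linear_combination hs
  linear_combination -h'

lemma RankOneSol.cubic {v : Fin 5 → ℂ} (h : RankOneSol v) (i : Fin 5) :
    2 * v i ^ 3 + 4 * esymmFive v * v i ^ 2 + (1 + 2 * esymmTwo v - 3 * esymmFour v) * v i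
      + 3 * esymmFive v = 0 := by
  have hs := h.sum
  have he := h.eq i
  rw [Finset.sum_erase_eq_sub (Finset.mem_univ i)] at he
  simp only [Fin.sum_univ_five] at hs he
  simp only [esymmTwo, esymmFour, esymmFive]
  fin_cases i <;> simp only [Fin.zero_eta, Fin.mk_one, Fin.reduceFinMk] at he ⊢
  · have := cubic_of_rational (a := v 0) (b := v 1) (c := v 2) (d := v 3) (e := v 4)
      (by linear_combination hs) (h.ne _ _ (by decide)) (h.ne _ _ (by decide))
      (h.ne _ _ (by decide)) (h.ne _ _ (by decide)) (by linear_combination he)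
    linear_combination this
  · have := cubic_of_rational (a := v 1) (b := v 0) (c := v 2) (d := v 3) (e := v 4)
      (by linear_combination hs) (h.ne _ _ (by decide)) (h.ne _ _ (by decide))
      (h.ne _ _ (by decide)) (h.ne _ _ (by decide)) (by linear_combination he)
    linear_combination this
  · have := cubic_of_rational (a := v 2) (b := v 0) (c := v 1) (d := v 3) (e := v 4)
      (by linear_combination hs) (h.ne _ _ (by decide)) (h.ne _ _ (by decide))
      (h.ne _ _ (by decide)) (h.ne _ _ (by decide)) (by linear_combination he)
    linear_combination this
  · have := cubic_of_rational (a := v 3) (b := v 0) (c := v 1) (d := v 2) (e := v 4)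
      (by linear_combination hs) (h.ne _ _ (by decide)) (h.ne _ _ (by decide))
      (h.ne _ _ (by decide)) (h.ne _ _ (by decide)) (by linear_combination he)
    linear_combination this
  · have := cubic_of_rational (a := v 4) (b := v 0) (c := v 1) (d := v 2) (e := v 3)
      (by linear_combination hs) (h.ne _ _ (by decide)) (h.ne _ _ (by decide))
      (h.ne _ _ (by decide)) (h.ne _ _ (by decide)) (by linear_combination he)
    linear_combination this

/-- Pattern `α, α, α, β, γ` with distinct `α, β, γ` does not occur. -/
lemma RankOneSol.not_three_one_one {v : Fin 5 → ℂ} (h : RankOneSol v) (h01 : v 0 = v 1)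
    (h02 : v 0 = v 2) (h03 : v 0 ≠ v 3) (h04 : v 0 ≠ v 4) (h34 : v 3 ≠ v 4) : False := by
  obtain ⟨hb, hc, hd⟩ := cubic_coeffs_of_three_roots h03 h04 h34
    (h.cubic 0) (h.cubic 3) (h.cubic 4)
  have hs := h.sum
  have h1 := h.ne 0 3 (by decide)
  have h2 := h.ne 0 4 (by decide)
  simp only [Fin.sum_univ_five, esymmTwo, esymmFour, esymmFive, ← h01, ← h02] at hs hb hc hd
  generalize v 0 = α at *
  generalize v 3 = β at *
  generalize v 4 = γ at *
  obtain rfl : γ = -3 * α - β := by linear_combination hs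
  -- Vieta for the sum and for the product of the three roots, with `esymmFive v = α ^ 3 * β * γ`
  -- and `3 * α + β + γ = 0`.
  have e1 : α * (α ^ 2 * (β * (-3 * α - β)) - 1) = 0 := by linear_combination hb / 4
  have e2 : α * (β * (-3 * α - β)) * (3 * α ^ 2 + 2) = 0 := by linear_combination hd
  rcases mul_eq_zero.1 e1 with h0 | e1
  · subst h0
    have : (1 : ℂ) = 0 := by linear_combination hc
    simp at this
  · have hα : α ≠ 0 := by rintro rfl; simp at e1
    have hβ : β * (-3 * α - β) ≠ 0 := by intro h'; rw [h'] at e1; simp at e1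
    have e3 : 3 * α ^ 2 + 2 = 0 := by
      simpa [hα, hβ] using (mul_eq_zero.1 e2).resolve_left (mul_ne_zero hα hβ)
    -- Here `(1 - α * β) * (1 - α * γ) = 1 + 3 * α ^ 2 + α ^ 2 * β * γ`, which vanishes because `α ^
    -- 2 * β * γ = 1` and `3 * α ^ 2 = -2`: a forbidden denominator.
    exact mul_ne_zero h1 h2 (by linear_combination e1 + e3)

/-- Pattern `α, α, β, β, γ` with distinct `α, β, γ`. -/
lemma RankOneSol.two_two_one {v : Fin 5 → ℂ} (h : RankOneSol v) (h01 : v 0 = v 1)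
    (h23 : v 2 = v 3) (h02 : v 0 ≠ v 2) (h04 : v 0 ≠ v 4) (h24 : v 2 ≠ v 4) :
    v 4 = 0 ∧ v 2 = - v 0 ∧ v 0 ^ 2 = 1 / 3 := by
  obtain ⟨hb, hc, hd⟩ := cubic_coeffs_of_three_roots h02 h04 h24
    (h.cubic 0) (h.cubic 2) (h.cubic 4)
  have hs := h.sum
  have h1 := h.ne 0 2 (by decide)
  simp only [Fin.sum_univ_five, esymmTwo, esymmFour, esymmFive, ← h01, ← h23] at hs hb hc hd
  generalize v 0 = α at *
  generalize v 2 = β at *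
  generalize v 4 = γ at *
  have hγ' : γ = -2 * (α + β) := by linear_combination hs
  -- If `γ ≠ 0`, Vieta gives `4 * (α * β) ^ 2 = -1` from the sum of the roots and `α * β = 0` or `-2
  -- / 3` from their product, which are incompatible.
  have hγ0 : γ = 0 := by
    by_contra hne
    have e1 : 4 * (α * β) ^ 2 + 1 = 0 :=
      mul_left_cancel₀ hne (by linear_combination hb - hγ')
    have e2 : (α * β) * (3 * (α * β) + 2) = 0 :=
      mul_left_cancel₀ hne (by linear_combination hd)
    rcases mul_eq_zero.1 e2 with e2 | e2
    · rw [e2] at e1; simp at e1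
    · have : α * β = -2 / 3 := by linear_combination e2 / 3
      rw [this] at e1; norm_num at e1
  subst hγ0
  have hβ : β = -α := by linear_combination hγ' / 2
  subst hβ
  refine ⟨rfl, rfl, ?_⟩
  have e : (1 - α * -α) * (3 * α ^ 2 - 1) = 0 := by linear_combination -hc
  have := (mul_eq_zero.1 e).resolve_left h1
  linear_combination this / 3

/-- Pattern `α, α, β, β, β` with `α ≠ β`. -/
lemma RankOneSol.two_three {v : Fin 5 → ℂ} (h : RankOneSol v) (h01 : v 0 = v 1)
    (h23 : v 2 = v 3) (h24 : v 2 = v 4) (h02 : v 0 ≠ v 2) :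
    ∃ s : ℂ, s ^ 2 = 1 / 24 ∧ v = ![3 * s, 3 * s, -2 * s, -2 * s, -2 * s] := by
  have hs := h.sum
  have he := h.eq 0
  have n1 := h.ne 0 1 (by decide)
  have n2 := h.ne 0 2 (by decide)
  rw [Finset.sum_erase_eq_sub (Finset.mem_univ _)] at he
  simp only [Fin.sum_univ_five, ← h01, ← h23, ← h24] at hs he n1
  have ev : v = ![v 0, v 0, v 2, v 2, v 2] := by
    funext i; fin_cases i <;> simp [h01, ← h23, ← h24]
  rw [ev]
  generalize v 0 = α at *
  generalize v 2 = β at *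
  obtain rfl : β = -2 * (α / 3) := by linear_combination hs / 3
  refine ⟨α / 3, ?_, by simp [show 3 * (α / 3) = α by ring]⟩
  have hα : α ≠ 0 := by rintro rfl; simp at h02
  have he' : α / (1 - α * α) + (3 * (-2 * (α / 3)) / (1 - α * (-2 * (α / 3)))) = 0 := by
    linear_combination he
  rw [div_add_div _ _ n1 n2, div_eq_zero_iff] at he'
  have := he'.resolve_right (mul_ne_zero n1 n2)
  have h2 : 8 * α ^ 2 - 3 = 0 := mul_left_cancel₀ hα (by linear_combination 3 * this)
  linear_combination h2 / 72

/-- Pattern `α, α, α, α, β`. -/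
lemma RankOneSol.four_one {v : Fin 5 → ℂ} (h : RankOneSol v) (h01 : v 0 = v 1)
    (h02 : v 0 = v 2) (h03 : v 0 = v 3) : v = 0 := by
  have hs := h.sum
  have he := h.eq 4
  have n1 := h.ne 0 4 (by decide)
  rw [Finset.sum_erase_eq_sub (Finset.mem_univ _)] at he
  simp only [Fin.sum_univ_five, ← h01, ← h02, ← h03] at hs he
  have h4 : v 4 = -4 * v 0 := by linear_combination hs
  have he' : 4 * v 0 / (1 - v 4 * v 0) = 0 := by linear_combination he
  rw [div_eq_zero_iff] at he'
  have h0 : v 0 = 0 := by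
    rcases he' with he' | he'
    · simpa using he'
    · exact absurd (by linear_combination he') n1
  funext i; fin_cases i <;> simp [← h01, ← h02, ← h03, h4, h0]

/-! ### Coincidence patterns of rank one solutions -/

lemma exists_perm_pair {i j : Fin 5} (h : i ≠ j) :
    ∃ s : Equiv.Perm (Fin 5), s 0 = i ∧ s 1 = j := by
  revert i j; decide +kernel

/-- The three types of rank one solutions. -/
def IsRankOneType (v : Fin 5 → ℂ) : Prop :=
  v = 0 ∨ ∃ p : Equiv.Perm (Fin 5), ∃ s : ℂ,
    (s ^ 2 = 1 / 24 ∧ v ∘ p = ![3 * s, 3 * s, -2 * s, -2 * s, -2 * s]) ∨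
    (s ^ 2 = 1 / 3 ∧ v ∘ p = ![0, s, -s, s, -s])

lemma IsRankOneType.of_comp {v : Fin 5 → ℂ} (q : Equiv.Perm (Fin 5))
    (h : IsRankOneType (v ∘ q)) : IsRankOneType v := by
  rcases h with h | ⟨p, s, h⟩
  · left
    funext i
    simpa using congrFun h (q.symm i)
  · exact Or.inr ⟨p.trans q, s, h⟩

lemma RankOneSol.isRankOneType_of_two_pairs {w : Fin 5 → ℂ} (hw : RankOneSol w)
    (h01 : w 0 = w 1) (h23 : w 2 = w 3) : IsRankOneType w := by
  by_cases h02 : w 0 = w 2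
  · exact Or.inl (hw.four_one h01 h02 (h02.trans h23))
  by_cases h24 : w 2 = w 4
  · obtain ⟨s, hs, e⟩ := hw.two_three h01 h23 h24 h02
    exact Or.inr ⟨1, s, Or.inl ⟨hs, e⟩⟩
  by_cases h04 : w 0 = w 4
  · let p : Equiv.Perm (Fin 5) := ⟨![2, 3, 0, 1, 4], ![2, 3, 0, 1, 4], by decide, by decide⟩
    obtain ⟨s, hs, e⟩ := (hw.comp p).two_three (by simp [p, h23]) (by simp [p, h01])
      (by simp [p, h04]) (by simpa [p] using Ne.symm h02)
    exact Or.inr ⟨p, s, Or.inl ⟨hs, e⟩⟩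
  -- The apex (value 0) goes first and the two values alternate, so that equal values sit at
  -- opposite base vertices, as in `pyramid`.
  · let p : Equiv.Perm (Fin 5) := ⟨![4, 0, 2, 1, 3], ![1, 3, 2, 4, 0], by decide, by decide⟩
    obtain ⟨e4, e2, e0⟩ := hw.two_two_one h01 h23 h02 h04 h24
    refine Or.inr ⟨p, w 0, Or.inr ⟨e0, ?_⟩⟩
    funext i
    fin_cases i <;> simp [p, ← h01, ← h23, e4, e2]

lemma RankOneSol.isRankOneType_of_triple {w : Fin 5 → ℂ} (hw : RankOneSol w)
    (h01 : w 0 = w 1) (h02 : w 0 = w 2) : IsRankOneType w := by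
  by_cases h34 : w 3 = w 4
  · let p : Equiv.Perm (Fin 5) := ⟨![0, 1, 3, 4, 2], ![0, 1, 4, 2, 3], by decide, by decide⟩
    exact .of_comp p ((hw.comp p).isRankOneType_of_two_pairs (by simp [p, h01]) (by simp [p, h34]))
  by_cases h03 : w 0 = w 3
  · exact Or.inl (hw.four_one h01 h02 h03)
  by_cases h04 : w 0 = w 4
  · let p : Equiv.Perm (Fin 5) := ⟨![0, 1, 2, 4, 3], ![0, 1, 2, 4, 3], by decide, by decide⟩
    exact .of_comp p (Or.inl ((hw.comp p).four_one (by simp [p, h01]) (by simp [p, h02])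
      (by simp [p, h04])))
  · exact (hw.not_three_one_one h01 h02 h03 h04 h34).elim

/-- The classification of rank one solutions up to permutation. -/
theorem RankOneSol.isRankOneType {v : Fin 5 → ℂ} (h : RankOneSol v) : IsRankOneType v := by
  -- Five distinct values would already give four distinct roots of the common cubic.
  have hinj : ∃ i j, i ≠ j ∧ v i = v j := by
    by_contra! hne
    exact not_four_roots (hne 0 1 (by decide)) (hne 0 2 (by decide)) (hne 0 3 (by decide))
      (hne 1 2 (by decide)) (hne 1 3 (by decide)) (hne 2 3 (by decide)) (h.cubic 0) (h.cubic 1)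
      (h.cubic 2) (h.cubic 3)
  obtain ⟨i, j, hij, hv⟩ := hinj
  obtain ⟨q, rfl, rfl⟩ := exists_perm_pair hij
  apply IsRankOneType.of_comp q
  replace h := h.comp q
  replace hv : (v ∘ q) 0 = (v ∘ q) 1 := hv
  generalize v ∘ q = v at *
  by_cases h23 : v 2 = v 3
  · exact h.isRankOneType_of_two_pairs hv h23
  by_cases h24 : v 2 = v 4
  · let p : Equiv.Perm (Fin 5) := ⟨![0, 1, 2, 4, 3], ![0, 1, 2, 4, 3], by decide, by decide⟩
    exact .of_comp p ((h.comp p).isRankOneType_of_two_pairs (by simp [p, hv]) (by simp [p, h24]))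
  by_cases h34 : v 3 = v 4
  · let p : Equiv.Perm (Fin 5) := ⟨![0, 1, 3, 4, 2], ![0, 1, 4, 2, 3], by decide, by decide⟩
    exact .of_comp p ((h.comp p).isRankOneType_of_two_pairs (by simp [p, hv]) (by simp [p, h34]))
  by_cases h02 : v 0 = v 2
  · exact h.isRankOneType_of_triple hv h02
  by_cases h03 : v 0 = v 3
  · let p : Equiv.Perm (Fin 5) := ⟨![0, 1, 3, 2, 4], ![0, 1, 3, 2, 4], by decide, by decide⟩
    exact .of_comp p ((h.comp p).isRankOneType_of_triple (by simp [p, hv]) (by simp [p, h03]))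
  by_cases h04 : v 0 = v 4
  · let p : Equiv.Perm (Fin 5) := ⟨![0, 1, 4, 3, 2], ![0, 1, 4, 3, 2], by decide, by decide⟩
    exact .of_comp p ((h.comp p).isRankOneType_of_triple (by simp [p, hv]) (by simp [p, h04]))
  -- Only `v 0 = v 1` is left as a coincidence, so `v 0, v 2, v 3, v 4` would be four distinct
  -- roots.
  exact (not_four_roots h02 h03 h04 h23 h24 h34 (h.cubic 0) (h.cubic 2) (h.cubic 3)
    (h.cubic 4)).elim

/-! ### The critical equations in matrix form -/

/-- The equations of the critical ideal for five points, for symmetric matrices `x` and `z`. -/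
structure IsSolution {R : Type*} [CommRing R] (x z : Matrix (Fin 5) (Fin 5) R) : Prop where
  x_symm : ∀ i j, x i j = x j i
  z_symm : ∀ i j, z i j = z j i
  x_diag : ∀ i, x i i = 1
  z_diag : ∀ i, z i i = 0
  center : ∀ i, ∑ j, x i j = 0
  aux : ∀ i j, i ≠ j → z i j * (1 - x i j) = 1
  grad : ∀ k i, ∑ j, (x i k - x i j) * z k j = 4 * x i k

lemma mem_permOrbit_of_submatrix_eq {n : ℕ} {R : Type*} {X Y : Matrix (Fin n) (Fin n) R}
    (s : Equiv.Perm (Fin n)) (h : X.submatrix s s = Y) : X ∈ permOrbit Y := by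
  refine ⟨s.symm, ?_⟩
  subst h
  ext i j
  simp

namespace IsSolution

lemma submatrix {R : Type*} [CommRing R] {x z : Matrix (Fin 5) (Fin 5) R} (h : IsSolution x z)
    (s : Equiv.Perm (Fin 5)) : IsSolution (x.submatrix s s) (z.submatrix s s) where
  x_symm i j := h.x_symm _ _
  z_symm i j := h.z_symm _ _
  x_diag i := h.x_diag _
  z_diag i := h.z_diag _
  center i := by rw [← h.center (s i)]; exact Equiv.sum_comp s fun j => x (s i) j
  aux i j hij := h.aux _ _ (s.injective.ne hij)
  grad k i := by
    rw [Matrix.submatrix_apply, ← h.grad (s k) (s i)]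
    exact Equiv.sum_comp s fun j => (x (s i) (s k) - x (s i) j) * z (s k) j

variable {x z : Matrix (Fin 5) (Fin 5) ℂ}

lemma x_ne_one (h : IsSolution x z) {i j : Fin 5} (hij : i ≠ j) : x i j ≠ 1 := by
  intro e
  have := h.aux i j hij
  rw [e] at this
  simp at this

lemma z_ne_zero (h : IsSolution x z) {i j : Fin 5} (hij : i ≠ j) : z i j ≠ 0 := by
  intro e
  have := h.aux i j hij
  rw [e] at this
  simp at this

lemma x_eq (h : IsSolution x z) {i j : Fin 5} (hij : i ≠ j) : x i j = 1 - 1 / z i j := by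
  have := h.z_ne_zero hij
  field_simp
  linear_combination -h.aux i j hij

/-- The difference of the Laplacian of the weights `z` and the Laplacian with constant weights
`4 / 5`. -/
def defect (z : Matrix (Fin 5) (Fin 5) ℂ) : Matrix (Fin 5) (Fin 5) ℂ :=
  Matrix.of fun i j => (if i = j then ∑ k, z i k - 4 else - z i j) + 4 / 5

lemma defect_symm (h : IsSolution x z) (i j : Fin 5) : defect z i j = defect z j i := by
  by_cases hij : i = j
  · rw [hij]
  · simp [defect, hij, Ne.symm hij, h.z_symm i j]

lemma defect_of_ne (z : Matrix (Fin 5) (Fin 5) ℂ) {i j : Fin 5} (hij : i ≠ j) :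
    defect z i j = 4 / 5 - z i j := by
  simp [defect, hij]; ring

/-- Applied to a constant vector this gives `N 1 = 0`; applied to a row of `x`, where the gradient
and center equations cancel everything, it gives `x N = 0`. -/
lemma sum_defect_mul (h : IsSolution x z) (k : Fin 5) (y : Fin 5 → ℂ) :
    ∑ j, defect z k j * y j = ∑ j, (y k - y j) * z k j - 4 * y k + 4 / 5 * ∑ j, y j := by
  have hz := h.z_diag k
  have e : ∀ j, defect z k j * y j
      = (if k = j then (∑ i, z k i - 4) * y k else 0) - z k j * y j + 4 / 5 * y j := by
    intro j
    by_cases hj : k = j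
    · subst hj; simp [defect, hz]; ring
    · simp [defect, hj]; ring
  simp only [e, Finset.sum_add_distrib, Finset.sum_sub_distrib, Finset.sum_ite_eq,
    Finset.mem_univ, if_true, sub_mul, ← Finset.mul_sum]
  simp only [mul_comm]
  ring

lemma sum_defect (h : IsSolution x z) (k : Fin 5) : ∑ j, defect z k j = 0 := by
  have := h.sum_defect_mul k 1
  simp at this
  exact this

lemma sum_mul_defect (h : IsSolution x z) (i k : Fin 5) : ∑ j, x i j * defect z j k = 0 := by
  have := h.sum_defect_mul k (fun j => x i j)
  rw [h.grad k i, h.center i] at this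
  simp only [h.defect_symm _ k, mul_comm (x i _)]
  rw [this]; ring

/-- The columns `b`, `d` of `N` and the vector `1` all lie in the kernel of `x`, which has dimension
at most 2. The minor of `N` is the determinant of a product `A * B` in which `B`, formed by these
three columns, has rank at most 2. -/
lemma defect_minor (h : IsSolution x z) (hr : 3 ≤ x.rank) (a b c d : Fin 5) :
    defect z a b * defect z c d = defect z a d * defect z c b := by
  let N := defect z
  let B : Matrix (Fin 5) (Fin 3) ℂ := Matrix.of fun i => ![N i b, N i d, 1]
  -- Two rows select the coordinates `a` and `c`. The third is the pairing with `1 / 5` times the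
  -- vector `1`: it kills the columns of `N` and sends `1` to 1, so the determinant reduces to the 2
  -- by 2 minor.
  let A : Matrix (Fin 3) (Fin 5) ℂ := Matrix.of ![Pi.single a 1, Pi.single c 1, fun _ => 1 / 5]
  have hB : x * B = 0 := by
    ext i j
    fin_cases j
    · simpa [Matrix.mul_apply, B] using h.sum_mul_defect i b
    · simpa [Matrix.mul_apply, B] using h.sum_mul_defect i d
    · simpa [Matrix.mul_apply, B] using h.center i
  have h1 := Matrix.rank_add_rank_le_card_of_mul_eq_zero hB
  have h2 := Matrix.rank_mul_le_right A B
  simp only [Fintype.card_fin] at h1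
  have hdet : (A * B).det = 0 := by
    by_contra hne
    have := Matrix.rank_of_det_ne_zero hne
    simp only [Fintype.card_fin] at this
    omega
  have hcol : ∀ b, ∑ i, N i b = 0 := fun b => by
    rw [← h.sum_defect b]; exact Finset.sum_congr rfl fun i _ => h.defect_symm _ _
  have e : A * B = !![N a b, N a d, 1; N c b, N c d, 1; 0, 0, 1] := by
    ext i j
    fin_cases i <;> fin_cases j <;>
      simp [Matrix.mul_apply, A, B, ← Finset.mul_sum, hcol, Pi.single_apply]
  rw [e, Matrix.det_fin_three] at hdet
  simp at hdet
  linear_combination hdet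

/-- A symmetric matrix with vanishing 2 by 2 minors is a column divided by a square root of its
nonzero diagonal entry, times its transpose. If the whole diagonal vanishes, the minors give `N i j
^ 2 = 0`. -/
lemma exists_defect_eq (h : IsSolution x z) (hr : 3 ≤ x.rank) :
    ∃ u : Fin 5 → ℂ, ∀ i j, defect z i j = u i * u j := by
  by_cases h0 : ∃ a, defect z a a ≠ 0
  · obtain ⟨a, ha⟩ := h0
    obtain ⟨s, hs⟩ := IsAlgClosed.exists_pow_nat_eq (defect z a a) (n := 2) (by norm_num)
    have hs0 : s ≠ 0 := by rintro rfl; simp at hs; exact ha hs.symm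
    refine ⟨fun i => defect z i a / s, fun i j => ?_⟩
    field_simp
    rw [hs, h.defect_minor hr i j a a, h.defect_symm a j]
  · push Not at h0
    refine ⟨0, fun i j => ?_⟩
    have := h.defect_minor hr i j j i
    rw [h0, h.defect_symm j i] at this
    simpa using this

/-- Solutions of rank at least three come from rank one solutions. -/
lemma exists_rankOneSol (h : IsSolution x z) (hr : 3 ≤ x.rank) :
    ∃ v : Fin 5 → ℂ, RankOneSol v ∧ ∀ i j, i ≠ j → z i j = 4 / 5 * (1 - v i * v j) := by
  obtain ⟨u, hu⟩ := h.exists_defect_eq hr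
  -- Rescaling by a square root of `4 / 5` turns `z i j = 4 / 5 - u i * u j` into `4 / 5 * (1 - v i
  -- * v j)`.
  obtain ⟨c, hc⟩ := IsAlgClosed.exists_pow_nat_eq (4 / 5 : ℂ) (n := 2) (by norm_num)
  have hc0 : c ≠ 0 := by rintro rfl; norm_num at hc
  have hz : ∀ i j, i ≠ j → z i j = 4 / 5 * (1 - u i / c * (u j / c)) := by
    intro i j hij
    have := hu i j
    rw [defect_of_ne z hij] at this
    rw [← hc]
    field_simp
    rw [hc]
    linear_combination -this
  -- With `N = u uᵀ`, both `N 1 = 0` and `x N = 0` read "scalar times `u k` is zero for all `k`";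
  -- the desired scalar identities are trivial when `u = 0`.
  have hcancel : ∀ y : ℂ, (∀ k, y * u k = 0) → u = 0 ∨ y = 0 := by
    intro y hy
    by_cases h0 : y = 0
    · exact Or.inr h0
    · exact Or.inl (funext fun k => by simpa [h0] using hy k)
  have hsum : ∑ i, u i = 0 := by
    rcases hcancel (∑ i, u i) (fun k => by
      have := h.sum_defect k
      simp only [hu, ← Finset.mul_sum] at this
      rw [mul_comm, this]) with h0 | h0
    · simp [h0]
    · exact h0
  have hxu : ∀ i, ∑ j, x i j * u j = 0 := by
    intro i
    rcases hcancel (∑ j, x i j * u j) (fun k => by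
      have := h.sum_mul_defect i k
      simp only [hu, ← mul_assoc, ← Finset.sum_mul] at this
      exact this) with h0 | h0
    · simp [h0]
    · exact h0
  have hne : ∀ i j, i ≠ j → 1 - u i / c * (u j / c) ≠ 0 := by
    intro i j hij e
    apply h.z_ne_zero hij
    rw [hz i j hij, e, mul_zero]
  refine ⟨fun i => u i / c, ⟨by rw [← Finset.sum_div, hsum, zero_div], hne, fun i => ?_⟩, hz⟩
  -- Substituting `x i j = 1 - 1 / z i j` in `∑ j, x i j * u j = 0`, the terms `u j` add up to zero
  -- and only the rational sum survives.
  have e : ∀ j ∈ Finset.univ.erase i, x i j * u j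
      = u j - 5 / 4 * c * (u j / c / (1 - u i / c * (u j / c))) := by
    intro j hj
    have hij : i ≠ j := (Finset.ne_of_mem_erase hj).symm
    have := hne i j hij
    rw [h.x_eq hij, hz i j hij]
    generalize 1 - u i / c * (u j / c) = D at *
    field_simp
  have h1 := hxu i
  rw [← Finset.add_sum_erase _ _ (Finset.mem_univ i), Finset.sum_congr rfl e,
    Finset.sum_sub_distrib, ← Finset.mul_sum, h.x_diag] at h1
  have h2 := hsum
  rw [← Finset.add_sum_erase _ _ (Finset.mem_univ i)] at h2
  have h3 : 5 / 4 * c * ∑ j ∈ Finset.univ.erase i, u j / c / (1 - u i / c * (u j / c)) = 0 := by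
    linear_combination h2 - h1
  simpa [hc0] using h3

lemma mem_permOrbit_of_three_le_rank (h : IsSolution x z) (hr : 3 ≤ x.rank) :
    x ∈ permOrbit (toC simplex) ∨ x ∈ permOrbit (toC bipyramid) ∨ x ∈ permOrbit (toC pyramid) := by
  obtain ⟨v, hv, hz⟩ := h.exists_rankOneSol hr
  have hx : ∀ i j, x i j = if i = j then 1 else 1 - 1 / (4 / 5 * (1 - v i * v j)) := by
    intro i j
    split_ifs with hij
    · rw [hij, h.x_diag]
    · rw [h.x_eq hij, hz i j hij]
  rcases hv.isRankOneType with h0 | ⟨p, s, ⟨hs, e⟩ | ⟨hs, e⟩⟩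
  · left
    apply mem_permOrbit_of_submatrix_eq 1
    ext i j
    simp only [Matrix.submatrix_apply, hx, h0]
    fin_cases i <;> fin_cases j <;> simp [toC, simplex] <;> norm_num
  · right; left
    apply mem_permOrbit_of_submatrix_eq p
    have e' : ∀ i, v (p i) = _ := fun i => congrFun e i
    ext i j
    simp only [Matrix.submatrix_apply, hx, e', p.injective.eq_iff]
    have h1 : 3 * s * (3 * s) = 9 / 24 := by linear_combination 9 * hs
    have h2 : 2 * s * (2 * s) = 4 / 24 := by linear_combination 4 * hs
    have h3 : 2 * s * (3 * s) = 6 / 24 := by linear_combination 6 * hs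
    have h4 : 3 * s * (2 * s) = 6 / 24 := by linear_combination 6 * hs
    fin_cases i <;> fin_cases j <;> simp [toC, bipyramid, h1, h2, h3, h4] <;> norm_num
  · right; right
    apply mem_permOrbit_of_submatrix_eq p
    have e' : ∀ i, v (p i) = _ := fun i => congrFun e i
    ext i j
    simp only [Matrix.submatrix_apply, hx, e', p.injective.eq_iff]
    have h1 : s * s = 1 / 3 := by linear_combination hs
    fin_cases i <;> fin_cases j <;> simp [toC, pyramid, h1] <;> norm_num

end IsSolution

/-! ### Solutions of rank at most two -/

/-- The sum `ζ + ζ ^ 4` is a root of a quadratic with roots `2 * cosA` and `2 * cosB`; in the second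
case `ζ ^ 2` is the right choice. -/
lemma exists_primitiveRoot_five :
    ∃ ζ : ℂ, IsPrimitiveRoot ζ 5 ∧ ζ + ζ ^ 4 = 2 * (cosA : ℂ) ∧ ζ ^ 2 + ζ ^ 3 = 2 * (cosB : ℂ) := by
  obtain ⟨ζ, hζ⟩ := (inferInstance : HasEnoughRootsOfUnity ℂ 5).prim
  have h5 : ζ ^ 5 = 1 := hζ.pow_eq_one
  have hs : (1 : ℂ) + ζ + ζ ^ 2 + ζ ^ 3 + ζ ^ 4 = 0 := by
    have := hζ.geom_sum_eq_zero (by norm_num)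
    simp only [Finset.sum_range_succ, Finset.sum_range_zero] at this
    linear_combination this
  have hr : ((√5 : ℝ) : ℂ) ^ 2 = 5 := by
    rw [← Complex.ofReal_pow, Real.sq_sqrt (by norm_num)]; norm_num
  have hw : (2 * (ζ + ζ ^ 4) + 1 - (√5 : ℝ)) * (2 * (ζ + ζ ^ 4) + 1 + (√5 : ℝ)) = 0 := by
    linear_combination 4 * hs - hr + (8 + 4 * ζ ^ 3) * h5
  have hA : 2 * (cosA : ℂ) = (-1 + (√5 : ℝ)) / 2 := by simp [cosA]; ring
  have hB : 2 * (cosB : ℂ) = (-1 - (√5 : ℝ)) / 2 := by simp [cosB]; ring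
  rw [hA, hB]
  rcases mul_eq_zero.1 hw with e | e
  · exact ⟨ζ, hζ, by linear_combination e / 2, by linear_combination hs - e / 2⟩
  · refine ⟨ζ ^ 2, hζ.pow_of_coprime 2 (by norm_num), ?_, ?_⟩
    · linear_combination hs - e / 2 + ζ ^ 3 * h5
    · linear_combination e / 2 + ζ * h5

lemma pentagon_apply {ζ : ℂ} (hζ : ζ ^ 5 = 1) (hA : ζ + ζ ^ 4 = 2 * (cosA : ℂ))
    (hB : ζ ^ 2 + ζ ^ 3 = 2 * (cosB : ℂ)) (a b : Fin 5) :
    (pentagon a b : ℂ) = (ζ ^ (a : ℕ) * ζ ^ (4 * b : ℕ) + ζ ^ (4 * a : ℕ) * ζ ^ (b : ℕ)) / 2 := by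
  have red : ∀ m, ζ ^ m = ζ ^ (m % 5) := fun m => pow_eq_pow_mod m hζ
  have hA' : ζ ^ 4 + ζ = 2 * (cosA : ℂ) := by rw [← hA]; ring
  have hB' : ζ ^ 3 + ζ ^ 2 = 2 * (cosB : ℂ) := by rw [← hB]; ring
  rw [← pow_add, ← pow_add, red (a + 4 * b), red (4 * a + b)]
  fin_cases a <;> fin_cases b <;> simp [pentagon, hA, hB, hA', hB']

lemma cubic_eq_zero_of_injective {t : Fin 5 → ℂ} (ht : Function.Injective t) {a b c d : ℂ}
    (h : ∀ i, a + b * t i + c * t i ^ 2 + d * t i ^ 3 = 0) : a = 0 ∧ b = 0 ∧ c = 0 ∧ d = 0 := by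
  have := Matrix.eq_zero_of_forall_index_sum_pow_mul_eq_zero (f := t) (v := ![a, b, c, d, 0]) ht
    (fun i => by simp [Fin.sum_univ_five]; linear_combination h i)
  exact ⟨congrFun this 0, congrFun this 1, congrFun this 2, congrFun this 3⟩

/-- For `P` the monic quintic with roots `t, a, b, c, d`, the sum equals `-4 + t P''(t) / (2
P'(t))`, so the hypothesis is `t P''(t) = 4 P'(t)`. The terms of degree 4 cancel, and half the
difference is this cubic, with coefficients `-2 e4, 3 e3, -3 e2, 2 e1` in the elementary symmetric
functions of the five roots. -/
lemma cubic_of_sum_div {t a b c d : ℂ} (ha : t - a ≠ 0) (hb : t - b ≠ 0) (hc : t - c ≠ 0)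
    (hd : t - d ≠ 0) (h : a / (t - a) + b / (t - b) + c / (t - c) + d / (t - d) = -2) :
    -2 * (t * a * b * c + t * a * b * d + t * a * c * d + t * b * c * d + a * b * c * d)
      + 3 * (t * a * b + t * a * c + t * a * d + t * b * c + t * b * d + t * c * d + a * b * c
        + a * b * d + a * c * d + b * c * d) * t
      - 3 * (t * a + t * b + t * c + t * d + a * b + a * c + a * d + b * c + b * d + c * d) * t ^ 2
      + 2 * (t + a + b + c + d) * t ^ 3 = 0 := by
  rw [div_add_div _ _ ha hb, div_add_div _ _ (mul_ne_zero ha hb) hc,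
    div_add_div _ _ (mul_ne_zero (mul_ne_zero ha hb) hc) hd,
    div_eq_iff (mul_ne_zero (mul_ne_zero (mul_ne_zero ha hb) hc) hd)] at h
  linear_combination h

/-- Critical points on the complex circle have equal fifth powers. -/
lemma pow_five_eq {t : Fin 5 → ℂ} (ht : Function.Injective t)
    (h : ∀ i, ∑ j ∈ Finset.univ.erase i, t j / (t i - t j) = -2) (i : Fin 5) :
    t i ^ 5 = t 0 * t 1 * t 2 * t 3 * t 4 := by
  have ne : ∀ i j, i ≠ j → t i - t j ≠ 0 := fun i j hij => sub_ne_zero.2 (ht.ne hij)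
  have key := cubic_eq_zero_of_injective ht
    (a := -2 * (t 0 * t 1 * t 2 * t 3 + t 0 * t 1 * t 2 * t 4 + t 0 * t 1 * t 3 * t 4
      + t 0 * t 2 * t 3 * t 4 + t 1 * t 2 * t 3 * t 4))
    (b := 3 * (t 0 * t 1 * t 2 + t 0 * t 1 * t 3 + t 0 * t 1 * t 4 + t 0 * t 2 * t 3
      + t 0 * t 2 * t 4 + t 0 * t 3 * t 4 + t 1 * t 2 * t 3 + t 1 * t 2 * t 4 + t 1 * t 3 * t 4
      + t 2 * t 3 * t 4))
    (c := -3 * (t 0 * t 1 + t 0 * t 2 + t 0 * t 3 + t 0 * t 4 + t 1 * t 2 + t 1 * t 3 + t 1 * t 4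
      + t 2 * t 3 + t 2 * t 4 + t 3 * t 4))
    (d := 2 * (t 0 + t 1 + t 2 + t 3 + t 4)) (fun i => by
      have he := h i
      rw [Finset.sum_erase_eq_sub (Finset.mem_univ i)] at he
      simp only [Fin.sum_univ_five] at he
      fin_cases i <;> simp only [Fin.zero_eta, Fin.mk_one, Fin.reduceFinMk] at he ⊢
      · linear_combination cubic_of_sum_div (ne 0 1 (by decide)) (ne 0 2 (by decide))
          (ne 0 3 (by decide)) (ne 0 4 (by decide)) (by linear_combination he)
      · linear_combination cubic_of_sum_div (ne 1 0 (by decide)) (ne 1 2 (by decide))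
          (ne 1 3 (by decide)) (ne 1 4 (by decide)) (by linear_combination he)
      · linear_combination cubic_of_sum_div (ne 2 0 (by decide)) (ne 2 1 (by decide))
          (ne 2 3 (by decide)) (ne 2 4 (by decide)) (by linear_combination he)
      · linear_combination cubic_of_sum_div (ne 3 0 (by decide)) (ne 3 1 (by decide))
          (ne 3 2 (by decide)) (ne 3 4 (by decide)) (by linear_combination he)
      · linear_combination cubic_of_sum_div (ne 4 0 (by decide)) (ne 4 1 (by decide))
          (ne 4 2 (by decide)) (ne 4 3 (by decide)) (by linear_combination he))
  -- A cubic with five distinct roots is zero, so `e1, ..., e4` vanish and `∏ (T - t j)` is `T ^ 5 -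
  -- e5`.
  obtain ⟨e4, e3, e2, e1⟩ := key
  have hp : (t i - t 0) * (t i - t 1) * (t i - t 2) * (t i - t 3) * (t i - t 4) = 0 := by
    fin_cases i <;> simp
  linear_combination hp + t i ^ 4 / 2 * e1 + t i ^ 3 / 3 * e2 + t i ^ 2 / 3 * e3 + t i / 2 * e4

namespace IsSolution

variable {x z : Matrix (Fin 5) (Fin 5) ℂ}

/-- Parametrization of a solution of rank at most two by points of the complex circle. -/
lemma exists_circle_param (h : IsSolution x z) (hr : x.rank ≤ 2) :
    ∃ t t' : Fin 5 → ℂ, (∀ k, t k * t' k = 1) ∧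
      (∀ k j, x k j = (t k * t' j + t' k * t j) / 2) ∧
      ∀ k, ∑ j, (t k - t j) * z k j = 4 * t k := by
  -- Row 0 sums to zero, so its off-diagonal entries are not all `-1`; none is 1. Some `x 0 m` is
  -- therefore different from `±1`, and the principal minor on `0, m` is nonzero.
  obtain ⟨m, hm0, hm⟩ : ∃ m, 0 ≠ m ∧ x 0 m ≠ -1 := by
    by_contra! hne
    have := h.center 0
    rw [Fin.sum_univ_five, h.x_diag, hne 1 (by decide), hne 2 (by decide), hne 3 (by decide),
      hne 4 (by decide)] at this
    norm_num at this
  set c := x 0 m with hc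
  have hc1 : c ≠ 1 := h.x_ne_one hm0
  obtain ⟨s, hs⟩ := IsAlgClosed.exists_pow_nat_eq (c ^ 2 - 1) (n := 2) (by norm_num)
  have hs0 : s ≠ 0 := by
    rintro rfl
    have : (c - 1) * (c + 1) = 0 := by linear_combination -hs
    rcases mul_eq_zero.1 this with e | e
    · exact hc1 (sub_eq_zero.1 e)
    · exact hm (eq_neg_of_add_eq_zero_left e)
  -- Vanishing of the 3 by 3 minor on rows `0, m, k` and columns `0, m, j`: Gram–Schmidt on the
  -- points `0` and `m`, with `s ^ 2 = c ^ 2 - 1`.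
  have minor : ∀ k j, s ^ 2 * x k j
      = s ^ 2 * (x k 0 * x j 0) - (x k m - c * x k 0) * (x j m - c * x j 0) := by
    intro k j
    have hdet : (x.submatrix ![0, m, k] ![0, m, j]).det = 0 := by
      by_contra hne
      have h1 := Matrix.rank_of_det_ne_zero hne
      have h2 := Matrix.rank_submatrix_le x ![0, m, k] ![0, m, j]
      simp only [Fintype.card_fin] at h1
      omega
    rw [Matrix.det_fin_three] at hdet
    simp only [Matrix.submatrix_apply, Matrix.cons_val_zero, Matrix.cons_val_one,
      Matrix.cons_val, h.x_diag, h.x_symm m 0, h.x_symm 0 j, h.x_symm m j, ← hc] at hdet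
    rw [hs]
    linear_combination -hdet
  let y : Fin 5 → ℂ := fun k => (x k m - c * x k 0) / s
  have hy : ∀ k, s * y k = x k m - c * x k 0 := fun k => by simp only [y]; field_simp
  have hx : ∀ k j, x k j = x k 0 * x j 0 - y k * y j := by
    intro k j
    apply mul_left_cancel₀ (pow_ne_zero 2 hs0)
    rw [minor, ← hy, ← hy]; ring
  have hy4 : ∀ k, ∑ j, (y k - y j) * z k j = 4 * y k := by
    intro k
    have e : ∀ j, (y k - y j) * z k j
        = ((x m k - x m j) * z k j - c * ((x 0 k - x 0 j) * z k j)) / s := by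
      intro j
      simp only [y, h.x_symm _ m, h.x_symm _ 0]
      ring
    simp only [e]
    rw [← Finset.sum_div, Finset.sum_sub_distrib, ← Finset.mul_sum, h.grad, h.grad]
    simp only [y, h.x_symm _ m, h.x_symm _ 0]
    ring
  -- The form is `x k j = x k 0 * x j 0 - y k * y j`; isotropic coordinates turn the unit condition
  -- into `t * t' = 1`.
  refine ⟨fun k => x k 0 - y k, fun k => x k 0 + y k, fun k => ?_, fun k j => ?_, fun k => ?_⟩
  · linear_combination h.x_diag k - hx k k
  · rw [hx]; ring
  · have := h.grad k 0
    rw [← h.x_symm k 0] at this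
    have e : ∀ j, (x k 0 - y k - (x j 0 - y j)) * z k j
        = (x 0 k - x 0 j) * z k j - (y k - y j) * z k j := by
      intro j
      rw [h.x_symm k 0, h.x_symm j 0]; ring
    simp only [e]
    rw [Finset.sum_sub_distrib, h.grad, hy4, h.x_symm 0 k]
    ring

lemma mem_permOrbit_of_rank_le_two (h : IsSolution x z) (hr : x.rank ≤ 2) :
    x ∈ permOrbit (toC pentagon) := by
  obtain ⟨t, t', htt, hx, hgrad⟩ := h.exists_circle_param hr
  have ht0 : ∀ k, t k ≠ 0 := fun k e => by simpa [e] using htt k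
  have ht' : ∀ k, t' k = (t k)⁻¹ := fun k => eq_inv_of_mul_eq_one_right (htt k)
  have hinj : Function.Injective t := by
    intro i j e
    by_contra hij
    apply h.x_ne_one hij
    rw [hx, ht', ht', e]
    field_simp [ht0 j]
    norm_num
  have hsum : ∀ i, ∑ j ∈ Finset.univ.erase i, t j / (t i - t j) = -2 := by
    intro i
    -- On the circle `1 - x i j = -(t i - t j) ^ 2 / (2 * t i * t j)`.
    have e : ∀ j ∈ Finset.univ.erase i, (t i - t j) * z i j = -2 * t i * (t j / (t i - t j)) := by
      intro j hj
      have hij : i ≠ j := (Finset.ne_of_mem_erase hj).symm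
      have hne : t i - t j ≠ 0 := sub_ne_zero.2 (hinj.ne hij)
      have ha := h.aux i j hij
      rw [hx, ht', ht'] at ha
      have hi := ht0 i
      have hj := ht0 j
      have ha' : z i j * (t i - t j) ^ 2 = -2 * t i * t j := by
        field_simp at ha
        linear_combination -ha
      field_simp
      linear_combination ha'
    have := hgrad i
    rw [← Finset.add_sum_erase _ _ (Finset.mem_univ i), Finset.sum_congr rfl e,
      ← Finset.mul_sum] at this
    apply mul_left_cancel₀ (mul_ne_zero (by norm_num : (-2 : ℂ) ≠ 0) (ht0 i))
    linear_combination this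
  have h5 := pow_five_eq hinj hsum
  obtain ⟨ζ, hζ, hA, hB⟩ := exists_primitiveRoot_five
  -- All `t k` have the same fifth power, so they are `t 0` times fifth roots of unity; by
  -- injectivity all five roots occur, and the exponents form a permutation.
  have hroot : ∀ k, ∃ m : Fin 5, t k = t 0 * ζ ^ (m : ℕ) := by
    intro k
    have e : (t k / t 0) ^ 5 = 1 := by
      rw [div_pow, h5 k, ← h5 0, div_self (pow_ne_zero 5 (ht0 0))]
    obtain ⟨m, hm, he⟩ := hζ.eq_pow_of_pow_eq_one e
    exact ⟨⟨m, hm⟩, by simp only [he]; field_simp [ht0 0]⟩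
  choose m hm using hroot
  have hmi : Function.Injective m := fun i j e => hinj (by rw [hm i, hm j, e])
  refine ⟨Equiv.ofBijective m (Finite.injective_iff_bijective.1 hmi), ?_⟩
  ext k j
  have hinv : ∀ k, t' k = (t 0)⁻¹ * ζ ^ (4 * m k : ℕ) := by
    intro k
    rw [ht', inv_eq_iff_eq_inv, hm k, mul_inv, inv_inv]
    congr 1
    refine eq_inv_of_mul_eq_one_left ?_
    rw [← pow_add, show (m k : ℕ) + 4 * m k = 5 * m k by ring, pow_mul, hζ.pow_eq_one, one_pow]
  simp only [Matrix.submatrix_apply, Equiv.ofBijective_apply, toC, Matrix.map_apply]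
  rw [pentagon_apply hζ.pow_eq_one hA hB, hx, hinv, hinv, hm k, hm j]
  have := ht0 0
  field_simp

/-- Every complex solution is, up to permutation, one of the four matrices. -/
theorem mem_permOrbit (h : IsSolution x z) :
    x ∈ permOrbit (toC simplex) ∨ x ∈ permOrbit (toC bipyramid) ∨ x ∈ permOrbit (toC pyramid) ∨
      x ∈ permOrbit (toC pentagon) := by
  by_cases hr : 3 ≤ x.rank
  · have := h.mem_permOrbit_of_three_le_rank hr
    tauto
  · exact Or.inr (Or.inr (Or.inr (h.mem_permOrbit_of_rank_le_two (by omega))))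

end IsSolution

/-! ### The four matrices solve the critical equations -/

/-- The weights `1 / (1 - x i j)` off the diagonal. -/
def weights {K : Type*} [Field K] (x : Matrix (Fin 5) (Fin 5) K) : Matrix (Fin 5) (Fin 5) K :=
  Matrix.of fun i j => if i = j then 0 else (1 - x i j)⁻¹

lemma IsSolution.map {R S : Type*} [CommRing R] [CommRing S] {x z : Matrix (Fin 5) (Fin 5) R}
    (h : IsSolution x z) (f : R →+* S) : IsSolution (x.map f) (z.map f) where
  x_symm i j := by simp [h.x_symm i j]
  z_symm i j := by simp [h.z_symm i j]
  x_diag i := by simp [h.x_diag i]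
  z_diag i := by simp [h.z_diag i]
  center i := by simpa using congrArg f (h.center i)
  aux i j hij := by simpa using congrArg f (h.aux i j hij)
  grad k i := by
    have := congrArg f (h.grad k i)
    rw [map_mul, map_ofNat] at this
    simpa using this

lemma IsSolution.eq_weights {K : Type*} [Field K] {x z : Matrix (Fin 5) (Fin 5) K}
    (h : IsSolution x z) : z = weights x := by
  ext i j
  by_cases hij : i = j
  · subst hij; simp [weights, h.z_diag]
  · simp only [weights, Matrix.of_apply, hij, if_false]
    exact eq_inv_of_mul_eq_one_left (h.aux i j hij)

lemma cosA_add_cosB : cosA + cosB = -1 / 2 := by simp [cosA, cosB]; ring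

lemma cosA_mul_cosB : cosA * cosB = -1 / 4 := by
  have : (√5 : ℝ) ^ 2 = 5 := Real.sq_sqrt (by norm_num)
  simp only [cosA, cosB]; linear_combination -this / 16

/-- Both this and its companion say `(1 - cosA) * (1 - cosB) = 5 / 4`; the pentagon weights thus
become linear in the cosines. -/
lemma inv_one_sub_cosA : (1 - cosA)⁻¹ = 4 / 5 * (1 - cosB) :=
  inv_eq_of_mul_eq_one_right (by
    linear_combination 4 / 5 * cosA_mul_cosB - 4 / 5 * cosA_add_cosB)

lemma inv_one_sub_cosB : (1 - cosB)⁻¹ = 4 / 5 * (1 - cosA) :=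
  inv_eq_of_mul_eq_one_right (by
    linear_combination 4 / 5 * cosA_mul_cosB - 4 / 5 * cosA_add_cosB)

lemma cosB_eq : cosB = -1 / 2 - cosA := by linear_combination cosA_add_cosB

lemma cosA_sq : cosA ^ 2 = 1 / 4 - cosA / 2 := by
  have := cosA_mul_cosB
  rw [cosB_eq] at this
  linear_combination -this

lemma isSolution_simplex : IsSolution simplex (weights simplex) where
  x_symm i j := by fin_cases i <;> fin_cases j <;> simp [simplex]
  z_symm i j := by fin_cases i <;> fin_cases j <;> simp [weights, simplex]
  x_diag i := by fin_cases i <;> simp [simplex]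
  z_diag i := by simp [weights]
  center i := by fin_cases i <;> simp [simplex, Fin.sum_univ_five] <;> norm_num
  aux i j hij := by fin_cases i <;> fin_cases j <;> simp [weights, simplex] at hij ⊢ <;> norm_num
  grad k i := by
    fin_cases k <;> fin_cases i <;> simp [weights, simplex, Fin.sum_univ_five] <;> norm_num

lemma isSolution_bipyramid : IsSolution bipyramid (weights bipyramid) where
  x_symm i j := by fin_cases i <;> fin_cases j <;> simp [bipyramid]
  z_symm i j := by fin_cases i <;> fin_cases j <;> simp [weights, bipyramid]
  x_diag i := by fin_cases i <;> simp [bipyramid]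
  z_diag i := by simp [weights]
  center i := by fin_cases i <;> simp [bipyramid, Fin.sum_univ_five] <;> norm_num
  aux i j hij := by fin_cases i <;> fin_cases j <;> simp [weights, bipyramid] at hij ⊢ <;> norm_num
  grad k i := by
    fin_cases k <;> fin_cases i <;> simp [weights, bipyramid, Fin.sum_univ_five] <;> norm_num

lemma isSolution_pyramid : IsSolution pyramid (weights pyramid) where
  x_symm i j := by fin_cases i <;> fin_cases j <;> simp [pyramid]
  z_symm i j := by fin_cases i <;> fin_cases j <;> simp [weights, pyramid]
  x_diag i := by fin_cases i <;> simp [pyramid]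
  z_diag i := by simp [weights]
  center i := by fin_cases i <;> simp [pyramid, Fin.sum_univ_five] <;> norm_num
  aux i j hij := by fin_cases i <;> fin_cases j <;> simp [weights, pyramid] at hij ⊢ <;> norm_num
  grad k i := by
    fin_cases k <;> fin_cases i <;> simp [weights, pyramid, Fin.sum_univ_five] <;> norm_num

lemma weights_pentagon : weights pentagon =
    !![0, 4/5 * (1 - cosB), 4/5 * (1 - cosA), 4/5 * (1 - cosA), 4/5 * (1 - cosB);
       4/5 * (1 - cosB), 0, 4/5 * (1 - cosB), 4/5 * (1 - cosA), 4/5 * (1 - cosA);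
       4/5 * (1 - cosA), 4/5 * (1 - cosB), 0, 4/5 * (1 - cosB), 4/5 * (1 - cosA);
       4/5 * (1 - cosA), 4/5 * (1 - cosA), 4/5 * (1 - cosB), 0, 4/5 * (1 - cosB);
       4/5 * (1 - cosB), 4/5 * (1 - cosA), 4/5 * (1 - cosA), 4/5 * (1 - cosB), 0] := by
  ext i j
  fin_cases i <;> fin_cases j <;> simp [weights, pentagon, inv_one_sub_cosA, inv_one_sub_cosB]

lemma isSolution_pentagon : IsSolution pentagon (weights pentagon) where
  x_symm i j := by fin_cases i <;> fin_cases j <;> simp [pentagon]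
  z_symm i j := by fin_cases i <;> fin_cases j <;> simp [weights, pentagon]
  x_diag i := by fin_cases i <;> simp [pentagon]
  z_diag i := by simp [weights]
  center i := by
    fin_cases i <;> simp [pentagon, Fin.sum_univ_five] <;> linear_combination 2 * cosA_add_cosB
  aux i j hij := by
    rw [weights_pentagon]
    fin_cases i <;> fin_cases j <;> simp [pentagon] at hij ⊢ <;>
      linear_combination 4 / 5 * cosA_mul_cosB - 4 / 5 * cosA_add_cosB
  grad k i := by
    rw [weights_pentagon]
    have h := cosA_sq
    fin_cases k <;> fin_cases i <;> simp [pentagon, Fin.sum_univ_five, cosB_eq] <;>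
      ring_nf <;> rw [h] <;> ring

/-! ### Orbits -/

/-- The values of the entries of the four matrices, in increasing order. -/
def entryValue : Fin 9 → ℝ := ![-1, -7/8, cosB, -1/2, -1/4, 0, 1/16, cosA, 1]

/-- Distinctness of the entry values moves the orbit counts to patterns with entries in `Fin 9`,
where equality is decidable. -/
lemma entryValue_strictMono : StrictMono entryValue := by
  have h1 : (2.2 : ℝ) < √5 := by
    rw [Real.lt_sqrt (by norm_num)]; norm_num
  have h2 : √5 < (2.3 : ℝ) := by
    rw [Real.sqrt_lt' (by norm_num)]; norm_num
  rw [Fin.strictMono_iff_lt_succ]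
  intro i
  fin_cases i <;> simp [entryValue, cosA, cosB] <;> linarith

/-- The patterns of the four matrices. -/
def patterns : Fin 4 → Matrix (Fin 5) (Fin 5) (Fin 9) :=
  ![!![8, 4, 4, 4, 4; 4, 8, 4, 4, 4; 4, 4, 8, 4, 4; 4, 4, 4, 8, 4; 4, 4, 4, 4, 8],
    !![8, 0, 5, 5, 5; 0, 8, 5, 5, 5; 5, 5, 8, 3, 3; 5, 5, 3, 8, 3; 5, 5, 3, 3, 8],
    !![8, 4, 4, 4, 4; 4, 8, 6, 1, 6; 4, 6, 8, 6, 1; 4, 1, 6, 8, 6; 4, 6, 1, 6, 8],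
    !![8, 7, 2, 2, 7; 7, 8, 7, 2, 2; 2, 7, 8, 7, 2; 2, 2, 7, 8, 7; 7, 2, 2, 7, 8]]

lemma simplex_eq_map : simplex = (patterns 0).map entryValue := by
  ext i j; fin_cases i <;> fin_cases j <;> simp [simplex, patterns, entryValue]

lemma bipyramid_eq_map : bipyramid = (patterns 1).map entryValue := by
  ext i j; fin_cases i <;> fin_cases j <;> simp [bipyramid, patterns, entryValue]

lemma pyramid_eq_map : pyramid = (patterns 2).map entryValue := by
  ext i j; fin_cases i <;> fin_cases j <;> simp [pyramid, patterns, entryValue]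

lemma pentagon_eq_map : pentagon = (patterns 3).map entryValue := by
  ext i j; fin_cases i <;> fin_cases j <;> simp [pentagon, patterns, entryValue]

lemma permOrbit_map {n : ℕ} {R S : Type*} (X : Matrix (Fin n) (Fin n) R) (f : R → S) :
    permOrbit (X.map f) = (fun M => M.map f) '' permOrbit X := by
  simp only [permOrbit, ← Set.range_comp]
  rfl

/-- The orbit of a matrix with decidable entries as a finset. -/
def orbitFinset (X : Matrix (Fin 5) (Fin 5) (Fin 9)) : Finset (Matrix (Fin 5) (Fin 5) (Fin 9)) :=
  Finset.univ.image fun s : Equiv.Perm (Fin 5) => X.submatrix s s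

lemma coe_orbitFinset (X : Matrix (Fin 5) (Fin 5) (Fin 9)) : (orbitFinset X : Set _) = permOrbit X := by
  simp [orbitFinset, permOrbit]

lemma matrix_map_injective {n : ℕ} {R S : Type*} {f : R → S} (hf : Function.Injective f) :
    Function.Injective fun M : Matrix (Fin n) (Fin n) R => M.map f :=
  fun _ _ h => Matrix.ext fun i j => hf (congrFun (congrFun h i) j)

lemma ncard_permOrbit_map (X : Matrix (Fin 5) (Fin 5) (Fin 9)) :
    (permOrbit (X.map entryValue)).ncard = (orbitFinset X).card := by
  rw [permOrbit_map,
    Set.ncard_image_of_injective _ (matrix_map_injective entryValue_strictMono.injective),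
    ← coe_orbitFinset, Set.ncard_coe_finset]

/-- The set of entries is invariant under permutation. The values separating the orbits are `-1`
(bipyramid), `-7/8` (pyramid) and `cosA` (pentagon), with indices 0, 1 and 7. -/
lemma disjoint_orbitFinset {X Y : Matrix (Fin 5) (Fin 5) (Fin 9)} (a : Fin 9)
    (hX : ∃ i j, X i j = a) (hY : ∀ i j, Y i j ≠ a) :
    Disjoint (orbitFinset X) (orbitFinset Y) := by
  rw [Finset.disjoint_left]
  simp only [orbitFinset, Finset.mem_image, Finset.mem_univ, true_and, not_exists]
  rintro _ ⟨s, rfl⟩ t h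
  obtain ⟨i, j, rfl⟩ := hX
  have := congrFun (congrFun h (s.symm i)) (s.symm j)
  exact hY _ _ (by simpa using this)

lemma card_orbitFinset_simplex : (orbitFinset (patterns 0)).card = 1 := by decide +kernel
lemma card_orbitFinset_bipyramid : (orbitFinset (patterns 1)).card = 10 := by decide +kernel
lemma card_orbitFinset_pyramid : (orbitFinset (patterns 2)).card = 15 := by decide +kernel
lemma card_orbitFinset_pentagon : (orbitFinset (patterns 3)).card = 12 := by decide +kernel
lemma card_orbitFinset_union : (orbitFinset (patterns 0) ∪ orbitFinset (patterns 1) ∪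
    orbitFinset (patterns 2) ∪ orbitFinset (patterns 3)).card = 38 := by
  rw [Finset.card_union_of_disjoint, Finset.card_union_of_disjoint, Finset.card_union_of_disjoint,
    card_orbitFinset_simplex, card_orbitFinset_bipyramid, card_orbitFinset_pyramid,
    card_orbitFinset_pentagon]
  · exact (disjoint_orbitFinset 0 ⟨0, 1, by decide⟩ (by
      intro i j; fin_cases i <;> fin_cases j <;> decide)).symm
  · rw [Finset.disjoint_union_left]
    exact ⟨(disjoint_orbitFinset 1 ⟨1, 3, by decide⟩ (by
      intro i j; fin_cases i <;> fin_cases j <;> decide)).symm,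
      (disjoint_orbitFinset 1 ⟨1, 3, by decide⟩ (by
      intro i j; fin_cases i <;> fin_cases j <;> decide)).symm⟩
  · rw [Finset.disjoint_union_left, Finset.disjoint_union_left]
    exact ⟨⟨(disjoint_orbitFinset 7 ⟨0, 1, by decide⟩ (by
      intro i j; fin_cases i <;> fin_cases j <;> decide)).symm,
      (disjoint_orbitFinset 7 ⟨0, 1, by decide⟩ (by
      intro i j; fin_cases i <;> fin_cases j <;> decide)).symm⟩,
      (disjoint_orbitFinset 7 ⟨0, 1, by decide⟩ (by
      intro i j; fin_cases i <;> fin_cases j <;> decide)).symm⟩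

/-- The union of the four orbits, as complex matrices. -/
def criticalOrbits : Set (Matrix (Fin 5) (Fin 5) ℂ) :=
  permOrbit (toC simplex) ∪ permOrbit (toC bipyramid) ∪ permOrbit (toC pyramid) ∪
    permOrbit (toC pentagon)

lemma criticalOrbits_eq_image : criticalOrbits =
    (fun M : Matrix (Fin 5) (Fin 5) (Fin 9) => M.map (fun a => (entryValue a : ℂ))) ''
      (orbitFinset (patterns 0) ∪ orbitFinset (patterns 1) ∪ orbitFinset (patterns 2) ∪
        orbitFinset (patterns 3) : Finset (Matrix (Fin 5) (Fin 5) (Fin 9))) := by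
  simp only [Finset.coe_union, Set.image_union, coe_orbitFinset, criticalOrbits,
    ← permOrbit_map, simplex_eq_map, bipyramid_eq_map, pyramid_eq_map, pentagon_eq_map, toC,
    Matrix.map_map]
  rfl

lemma ncard_criticalOrbits : criticalOrbits.ncard = 38 := by
  rw [criticalOrbits_eq_image, Set.ncard_image_of_injective, Set.ncard_coe_finset,
    card_orbitFinset_union]
  exact matrix_map_injective (Complex.ofReal_injective.comp entryValue_strictMono.injective)

lemma isSolution_of_mem_permOrbit {R : Type*} [CommRing R] {X Z Y : Matrix (Fin 5) (Fin 5) R}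
    (h : IsSolution X Z) (hY : Y ∈ permOrbit X) : ∃ W, IsSolution Y W := by
  obtain ⟨s, rfl⟩ := hY
  exact ⟨_, h.submatrix s⟩

lemma exists_isSolution_iff {x : Matrix (Fin 5) (Fin 5) ℂ} :
    (∃ z, IsSolution x z) ↔ x ∈ criticalOrbits := by
  simp only [criticalOrbits, Set.mem_union, or_assoc]
  constructor
  · rintro ⟨z, h⟩
    exact h.mem_permOrbit
  · rintro (h | h | h | h)
    · exact isSolution_of_mem_permOrbit (isSolution_simplex.map Complex.ofRealHom) h
    · exact isSolution_of_mem_permOrbit (isSolution_bipyramid.map Complex.ofRealHom) h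
    · exact isSolution_of_mem_permOrbit (isSolution_pyramid.map Complex.ofRealHom) h
    · exact isSolution_of_mem_permOrbit (isSolution_pentagon.map Complex.ofRealHom) h

/-! ### Nondegeneracy of the solutions -/

/-- The linearization of the critical equations at `(x, z)`, in the increments `e` of `x`. -/
structure IsTangent {K : Type*} [Field K] (x z e : Matrix (Fin 5) (Fin 5) K) : Prop where
  symm : ∀ i j, e i j = e j i
  diag : ∀ i, e i i = 0
  center : ∀ i, ∑ j, e i j = 0
  grad : ∀ k i, ∑ j, ((e i k - e i j) * z k j + (x i k - x i j) * (z k j ^ 2 * e k j)) = 4 * e i k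

lemma eq_zero_of_upper {e : Matrix (Fin 5) (Fin 5) ℝ} (hs : ∀ i j, e i j = e j i)
    (hd : ∀ i, e i i = 0)
    (h : e 0 1 = 0 ∧ e 0 2 = 0 ∧ e 0 3 = 0 ∧ e 0 4 = 0 ∧ e 1 2 = 0 ∧ e 1 3 = 0 ∧ e 1 4 = 0 ∧
      e 2 3 = 0 ∧ e 2 4 = 0 ∧ e 3 4 = 0) : e = 0 := by
  have key : ∀ i j, i < j → e i j = 0 := by
    simp only [Fin.forall_fin_succ]
    simp [h]
  ext i j
  rcases lt_trichotomy i j with hij | rfl | hij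
  · exact key i j hij
  · exact hd i
  · rw [hs]; exact key j i hij

lemma weights_simplex : weights simplex =
    !![0, 4/5, 4/5, 4/5, 4/5;
       4/5, 0, 4/5, 4/5, 4/5;
       4/5, 4/5, 0, 4/5, 4/5;
       4/5, 4/5, 4/5, 0, 4/5;
       4/5, 4/5, 4/5, 4/5, 0] := by
  ext i j
  fin_cases i <;> fin_cases j <;> simp [weights, simplex] <;> norm_num

lemma weights_bipyramid : weights bipyramid =
    !![0, 1/2, 1, 1, 1;
       1/2, 0, 1, 1, 1;
       1, 1, 0, 2/3, 2/3;
       1, 1, 2/3, 0, 2/3;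
       1, 1, 2/3, 2/3, 0] := by
  ext i j
  fin_cases i <;> fin_cases j <;> simp [weights, bipyramid] <;> norm_num

lemma weights_pyramid : weights pyramid =
    !![0, 4/5, 4/5, 4/5, 4/5;
       4/5, 0, 16/15, 8/15, 16/15;
       4/5, 16/15, 0, 16/15, 8/15;
       4/5, 8/15, 16/15, 0, 16/15;
       4/5, 16/15, 8/15, 16/15, 0] := by
  ext i j
  fin_cases i <;> fin_cases j <;> simp [weights, pyramid] <;> norm_num

/-- Ten unknowns remain above the diagonal. The five center equations and five suitable gradient
equations already form an invertible system; the same plan serves the other three matrices, with a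
selection of gradient equations for each. -/
lemma IsTangent.simplex_eq_zero {e : Matrix (Fin 5) (Fin 5) ℝ}
    (h : IsTangent simplex (weights simplex) e) : e = 0 := by
  rw [weights_simplex] at h
  have hd := h.diag
  have hl : e 1 0 = e 0 1 ∧ e 2 0 = e 0 2 ∧ e 3 0 = e 0 3 ∧ e 4 0 = e 0 4 ∧ e 2 1 = e 1 2 ∧
      e 3 1 = e 1 3 ∧ e 4 1 = e 1 4 ∧ e 3 2 = e 2 3 ∧ e 4 2 = e 2 4 ∧ e 4 3 = e 3 4 :=
    ⟨h.symm _ _, h.symm _ _, h.symm _ _, h.symm _ _, h.symm _ _, h.symm _ _, h.symm _ _,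
      h.symm _ _, h.symm _ _, h.symm _ _⟩
  have c0 := h.center 0
  have c1 := h.center 1
  have c2 := h.center 2
  have c3 := h.center 3
  have c4 := h.center 4
  simp only [Fin.sum_univ_five, hl, hd] at c0 c1 c2 c3 c4
  have g01 := h.grad 0 1
  have g02 := h.grad 0 2
  have g03 := h.grad 0 3
  have g12 := h.grad 1 2
  have g13 := h.grad 1 3
  simp [simplex, Fin.sum_univ_five, hd, hl] at g01 g02 g03 g12 g13
  refine eq_zero_of_upper h.symm hd ⟨?_, ?_, ?_, ?_, ?_, ?_, ?_, ?_, ?_, ?_⟩ <;> linarith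

lemma IsTangent.bipyramid_eq_zero {e : Matrix (Fin 5) (Fin 5) ℝ}
    (h : IsTangent bipyramid (weights bipyramid) e) : e = 0 := by
  rw [weights_bipyramid] at h
  have hd := h.diag
  have hl : e 1 0 = e 0 1 ∧ e 2 0 = e 0 2 ∧ e 3 0 = e 0 3 ∧ e 4 0 = e 0 4 ∧ e 2 1 = e 1 2 ∧
      e 3 1 = e 1 3 ∧ e 4 1 = e 1 4 ∧ e 3 2 = e 2 3 ∧ e 4 2 = e 2 4 ∧ e 4 3 = e 3 4 :=
    ⟨h.symm _ _, h.symm _ _, h.symm _ _, h.symm _ _, h.symm _ _, h.symm _ _, h.symm _ _,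
      h.symm _ _, h.symm _ _, h.symm _ _⟩
  have c0 := h.center 0
  have c1 := h.center 1
  have c2 := h.center 2
  have c3 := h.center 3
  have c4 := h.center 4
  simp only [Fin.sum_univ_five, hl, hd] at c0 c1 c2 c3 c4
  have g01 := h.grad 0 1
  have g02 := h.grad 0 2
  have g03 := h.grad 0 3
  have g12 := h.grad 1 2
  have g13 := h.grad 1 3
  simp [bipyramid, Fin.sum_univ_five, hd, hl] at g01 g02 g03 g12 g13
  refine eq_zero_of_upper h.symm hd ⟨?_, ?_, ?_, ?_, ?_, ?_, ?_, ?_, ?_, ?_⟩ <;> linarith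

lemma IsTangent.pyramid_eq_zero {e : Matrix (Fin 5) (Fin 5) ℝ}
    (h : IsTangent pyramid (weights pyramid) e) : e = 0 := by
  rw [weights_pyramid] at h
  have hd := h.diag
  have hl : e 1 0 = e 0 1 ∧ e 2 0 = e 0 2 ∧ e 3 0 = e 0 3 ∧ e 4 0 = e 0 4 ∧ e 2 1 = e 1 2 ∧
      e 3 1 = e 1 3 ∧ e 4 1 = e 1 4 ∧ e 3 2 = e 2 3 ∧ e 4 2 = e 2 4 ∧ e 4 3 = e 3 4 :=
    ⟨h.symm _ _, h.symm _ _, h.symm _ _, h.symm _ _, h.symm _ _, h.symm _ _, h.symm _ _,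
      h.symm _ _, h.symm _ _, h.symm _ _⟩
  have c0 := h.center 0
  have c1 := h.center 1
  have c2 := h.center 2
  have c3 := h.center 3
  have c4 := h.center 4
  simp only [Fin.sum_univ_five, hl, hd] at c0 c1 c2 c3 c4
  have g01 := h.grad 0 1
  have g02 := h.grad 0 2
  have g10 := h.grad 1 0
  have g12 := h.grad 1 2
  have g13 := h.grad 1 3
  simp [pyramid, Fin.sum_univ_five, hd, hl] at g01 g02 g10 g12 g13
  refine eq_zero_of_upper h.symm hd ⟨?_, ?_, ?_, ?_, ?_, ?_, ?_, ?_, ?_, ?_⟩ <;> linarith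

lemma IsTangent.pentagon_eq_zero {e : Matrix (Fin 5) (Fin 5) ℝ}
    (h : IsTangent pentagon (weights pentagon) e) : e = 0 := by
  rw [weights_pentagon] at h
  have hd := h.diag
  have hl : e 1 0 = e 0 1 ∧ e 2 0 = e 0 2 ∧ e 3 0 = e 0 3 ∧ e 4 0 = e 0 4 ∧ e 2 1 = e 1 2 ∧
      e 3 1 = e 1 3 ∧ e 4 1 = e 1 4 ∧ e 3 2 = e 2 3 ∧ e 4 2 = e 2 4 ∧ e 4 3 = e 3 4 :=
    ⟨h.symm _ _, h.symm _ _, h.symm _ _, h.symm _ _, h.symm _ _, h.symm _ _, h.symm _ _,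
      h.symm _ _, h.symm _ _, h.symm _ _⟩
  have c0 := h.center 0
  have c1 := h.center 1
  have c2 := h.center 2
  have c3 := h.center 3
  have c4 := h.center 4
  simp only [Fin.sum_univ_five, hl, hd] at c0 c1 c2 c3 c4
  -- The gradient equations are first reduced to coefficients linear in `cosA` by `cosA_sq`.
  have g01 : ((-6/5) + (-4/5) * cosA) * e 0 1 + ((-2/5) + 12/5 * cosA) * e 0 3 + (8/5 + 12/5 *
      cosA) * e 0 4 + ((-4/5) + 4/5 * cosA) * e 1 2 + ((-4/5) + 4/5 * cosA) * e 1 3 + ((-6/5) +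
      (-4/5) * cosA) * e 1 4 = 0 := by
    have g := h.grad 0 1
    simp [pentagon, Fin.sum_univ_five, cosB_eq, hd, hl] at g
    linear_combination g - ((24/25 + 16/25 * cosA) * e 0 1 + ((-72/25) + 32/25 * cosA) * e 0 3 +
        (88/25 + 32/25 * cosA) * e 0 4) * cosA_sq
  have g02 : ((-8/5) + (-12/5) * cosA) * e 0 1 + ((-4/5) + 4/5 * cosA) * e 0 2 + (2/5 + (-12/5) *
      cosA) * e 0 3 + ((-6/5) + (-4/5) * cosA) * e 1 2 + ((-4/5) + 4/5 * cosA) * e 2 3 + ((-6/5) +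
      (-4/5) * cosA) * e 2 4 = 0 := by
    have g := h.grad 0 2
    simp [pentagon, Fin.sum_univ_five, cosB_eq, hd, hl] at g
    linear_combination g - (((-88/25) + (-32/25) * cosA) * e 0 1 + (16/25 + (-16/25) * cosA) * e 0
        2 + (72/25 + (-32/25) * cosA) * e 0 3) * cosA_sq
  have g03 : (2/5 + (-12/5) * cosA) * e 0 2 + ((-4/5) + 4/5 * cosA) * e 0 3 + ((-8/5) + (-12/5) *
      cosA) * e 0 4 + ((-6/5) + (-4/5) * cosA) * e 1 3 + ((-4/5) + 4/5 * cosA) * e 2 3 + ((-6/5) +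
      (-4/5) * cosA) * e 3 4 = 0 := by
    have g := h.grad 0 3
    simp [pentagon, Fin.sum_univ_five, cosB_eq, hd, hl] at g
    linear_combination g - ((72/25 + (-32/25) * cosA) * e 0 2 + (16/25 + (-16/25) * cosA) * e 0 3
        + ((-88/25) + (-32/25) * cosA) * e 0 4) * cosA_sq
  have g10 : ((-6/5) + (-4/5) * cosA) * e 0 1 + ((-6/5) + (-4/5) * cosA) * e 0 2 + ((-4/5) + 4/5 *
      cosA) * e 0 3 + ((-4/5) + 4/5 * cosA) * e 0 4 + (8/5 + 12/5 * cosA) * e 1 2 + ((-2/5) + 12/5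
      * cosA) * e 1 3 = 0 := by
    have g := h.grad 1 0
    simp [pentagon, Fin.sum_univ_five, cosB_eq, hd, hl] at g
    linear_combination g - ((24/25 + 16/25 * cosA) * e 0 1 + (88/25 + 32/25 * cosA) * e 1 2 +
        ((-72/25) + 32/25 * cosA) * e 1 3) * cosA_sq
  have g12 : (8/5 + 12/5 * cosA) * e 0 1 + ((-6/5) + (-4/5) * cosA) * e 0 2 + ((-6/5) + (-4/5) *
      cosA) * e 1 2 + ((-2/5) + 12/5 * cosA) * e 1 4 + ((-4/5) + 4/5 * cosA) * e 2 3 + ((-4/5) +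
      4/5 * cosA) * e 2 4 = 0 := by
    have g := h.grad 1 2
    simp [pentagon, Fin.sum_univ_five, cosB_eq, hd, hl] at g
    linear_combination g - ((88/25 + 32/25 * cosA) * e 0 1 + (24/25 + 16/25 * cosA) * e 1 2 +
        ((-72/25) + 32/25 * cosA) * e 1 4) * cosA_sq
  -- The multipliers of the ten equations are the entries of the inverse of the system over `ℚ(√5)`;
  -- the multiple of `cosA_sq` performs the reduction.
  refine eq_zero_of_upper h.symm hd ⟨?_, ?_, ?_, ?_, ?_, ?_, ?_, ?_, ?_, ?_⟩
  · linear_combination (3/10 + (-2/15) * cosA) * c0 + ((-1/30) + (-17/15) * cosA) * c1 + (1/3 +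
      (-1/3) * cosA) * c2 + ((-1/6) + (-1/3) * cosA) * c3 + ((-1/6)) * c4 + ((-1) * cosA) * g01 +
      (1/12 + (-1/2) * cosA) * g02 + ((-1/4) + (-1/6) * cosA) * g03 + (1/12 + 1/6 * cosA) * g10 +
      (1/4 + 1/6 * cosA) * g12 - ((34/15) * e 0 1 + ((-4/15)) * e 0 2 + ((-6/5)) * e 0 3 +
      ((-28/15)) * e 0 4 + ((-2/15)) * e 1 2 + ((-4/15)) * e 1 3 + (6/5) * e 1 4 + ((-2/5)) * e 2
      3 + (8/15) * e 2 4 + (2/15) * e 3 4) * cosA_sq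
  · linear_combination (1/5 + 2/15 * cosA) * c0 + ((-3/10) + (-1/5) * cosA) * c1 + ((-1/6) +
      (-2/3) * cosA) * c3 + ((-1/6)) * c4 + ((-1/3) + (-1/3) * cosA) * g01 + ((-1/6) + (-2/3) *
      cosA) * g03 + ((-1/12) + (-1/6) * cosA) * g10 + ((-1/4) + (-1/6) * cosA) * g12 - ((28/15) *
      e 0 2 + ((-22/15)) * e 0 3 + (2/3) * e 0 4 + ((-8/15)) * e 1 2 + ((-2/15)) * e 1 3 +
      ((-2/15)) * e 1 4 + ((-2/3)) * e 2 3 + ((-2/15)) * e 2 4 + (8/15) * e 3 4) * cosA_sq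
  · linear_combination (1/5 + 2/15 * cosA) * c0 + (11/30 + 4/5 * cosA) * c1 + ((-1/2) + (-2/3) *
      cosA) * c2 + (2/3 + 2/3 * cosA) * c3 + (1/6 + 1/3 * cosA) * c4 + (1/3 + 2/3 * cosA) * g01 +
      ((-1/12) + (-1/3) * cosA) * g02 + (7/12 + 2/3 * cosA) * g03 + ((-1/12) + (-1/6) * cosA) *
      g10 + ((-1/4) + (-1/6) * cosA) * g12 - (((-8/5)) * e 0 2 + (14/5) * e 0 3 + ((-2/15)) * e 0
      4 + (8/15) * e 1 2 + ((-2/5)) * e 1 3 + ((-14/15)) * e 1 4 + (2/15) * e 2 3 + (2/15) * e 2 4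
      + ((-8/15)) * e 3 4) * cosA_sq
  · linear_combination (3/10 + (-2/15) * cosA) * c0 + ((-1/30) + 8/15 * cosA) * c1 + (1/6 + cosA)
      * c2 + ((-1/3) + 1/3 * cosA) * c3 + (1/6 + (-1/3) * cosA) * c4 + (2/3 * cosA) * g01 + (5/6 *
      cosA) * g02 + ((-1/6) + 1/6 * cosA) * g03 + (1/12 + 1/6 * cosA) * g10 + (1/4 + 1/6 * cosA) *
      g12 - (((-34/15)) * e 0 1 + ((-2/15)) * e 0 3 + (4/3) * e 0 4 + (2/15) * e 1 2 + (4/5) * e 1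
      3 + ((-2/15)) * e 1 4 + (14/15) * e 2 3 + ((-8/15)) * e 2 4 + ((-2/15)) * e 3 4) * cosA_sq
  · linear_combination (7/15 + 8/15 * cosA) * c0 + ((-11/30) + (-7/15) * cosA) * c1 + (1/6 + 1/3 *
      cosA) * c2 + ((-1/3)) * c3 + ((-1/3) * cosA) * c4 + ((-1/2) + 1/3 * cosA) * g01 + ((-1/12) +
      1/2 * cosA) * g02 + ((-1/4) + (-1/6) * cosA) * g03 + (1/2 + 1/6 * cosA) * g10 + (1/6 +
      (-1/6) * cosA) * g12 - (((-2)) * e 0 1 + (4/5) * e 0 2 + ((-2/5)) * e 0 3 + (4/3) * e 0 4 +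
      (2/5) * e 1 2 + (4/5) * e 1 3 + ((-2/3)) * e 1 4 + (2/15) * e 2 3 + ((-8/15)) * e 2 4 +
      (2/15) * e 3 4) * cosA_sq
  · linear_combination ((-17/15) + (-13/15) * cosA) * c0 + (6/5 + 17/15 * cosA) * c1 + ((-5/6) +
      (-4/3) * cosA) * c2 + (1/2 + 1/3 * cosA) * c3 + ((-1/6)) * c4 + (2/3 + 1/3 * cosA) * g01 +
      ((-5/12) + (-5/6) * cosA) * g02 + (1/4 + 1/6 * cosA) * g03 + ((-3/4) + (-1/3) * cosA) * g10
      + ((-7/12) + (-2/3) * cosA) * g12 - ((2/5) * e 0 1 + ((-4/15)) * e 0 2 + (8/3) * e 0 3 +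
      (2/15) * e 0 4 + (2/3) * e 1 2 + ((-2/3)) * e 1 3 + ((-28/15)) * e 1 4 + ((-16/15)) * e 2 3
      + (2/15) * e 2 4 + ((-2/15)) * e 3 4) * cosA_sq
  · linear_combination (11/30 + 7/15 * cosA) * c0 + (1/5 + 7/15 * cosA) * c1 + (1/3 + 4/3 * cosA)
      * c2 + (1/3 + 1/3 * cosA) * c4 + ((-1/6) + 1/3 * cosA) * g01 + (5/12 + 5/6 * cosA) * g02 +
      (1/4 + 1/6 * cosA) * g03 + (1/6) * g10 + (1/6 + 2/3 * cosA) * g12 - (((-2/3)) * e 0 1 +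
      ((-4/15)) * e 0 2 + ((-16/15)) * e 0 3 + (2/5) * e 0 4 + ((-14/15)) * e 1 2 + (2/15) * e 1 3
      + (4/3) * e 1 4 + (4/3) * e 2 3 + ((-2/15)) * e 2 4 + ((-2/15)) * e 3 4) * cosA_sq
  · linear_combination (7/15 + 1/5 * cosA) * c0 + ((-11/30) + (-2/15) * cosA) * c1 + (4/3 + 2 *
      cosA) * c2 + ((-1/6)) * c4 + ((-1/6)) * g01 + (1/2 + 7/6 * cosA) * g02 + ((-1/6) + 1/6 *
      cosA) * g03 + (1/3 + 1/3 * cosA) * g10 + (2/3 + cosA) * g12 - (((-2/3)) * e 0 1 + ((-8/15))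
      * e 0 2 + ((-12/5)) * e 0 3 + ((-2/15)) * e 0 4 + ((-14/15)) * e 1 2 + (2/3) * e 1 3 +
      (12/5) * e 1 4 + (28/15) * e 2 3 + ((-2/15)) * e 2 4 + ((-2/15)) * e 3 4) * cosA_sq
  · linear_combination ((-17/15) + (-13/15) * cosA) * c0 + (31/30 + 4/5 * cosA) * c1 + ((-1/2) +
      (-7/3) * cosA) * c2 + (1/2 + 2/3 * cosA) * c3 + (1/3 + 1/3 * cosA) * c4 + (1) * g01 +
      ((-5/12) + (-5/3) * cosA) * g02 + (7/12 + 2/3 * cosA) * g03 + ((-3/4) + (-1/3) * cosA) * g10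
      + ((-7/12) + (-2/3) * cosA) * g12 - ((8/3) * e 0 1 + ((-32/15)) * e 0 2 + (64/15) * e 0 3 +
      ((-28/15)) * e 0 4 + (16/15) * e 1 2 + ((-4/3)) * e 1 3 + ((-8/5)) * e 1 4 + ((-4/3)) * e 2
      3 + (4/5) * e 2 4 + ((-8/15)) * e 3 4) * cosA_sq
  · linear_combination (7/15 + 8/15 * cosA) * c0 + ((-6/5) + (-9/5) * cosA) * c1 + ((-1/6) + (-1)
      * cosA) * c3 + (1/6 + (-1/3) * cosA) * c4 + ((-5/6) + (-1) * cosA) * g01 + ((-2/3) + (-1) *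
      cosA) * g03 + (1/2 + 1/6 * cosA) * g10 + (1/6 + (-1/6) * cosA) * g12 - ((4/15) * e 0 1 +
      (12/5) * e 0 2 + ((-46/15)) * e 0 3 + (2/15) * e 0 4 + ((-4/15)) * e 1 2 + (2/5) * e 1 3 +
      (2/5) * e 1 4 + ((-14/15)) * e 2 3 + ((-2/15)) * e 2 4 + (4/5) * e 3 4) * cosA_sq

/-! ### Ideals with finitely many nondegenerate zeros -/

section Unramified

open MvPolynomial

variable {σ : Type*}

lemma isCoprime_vanishingIdeal {p q : σ → ℂ} (h : p ≠ q) :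
    IsCoprime (vanishingIdeal ℂ {p} : Ideal (MvPolynomial σ ℂ)) (vanishingIdeal ℂ {q}) := by
  obtain ⟨v, hv⟩ := Function.ne_iff.1 h
  rw [Ideal.isCoprime_iff_exists]
  have hv' : q v - p v ≠ 0 := sub_ne_zero.2 hv.symm
  refine ⟨C (q v - p v)⁻¹ * (X v - C (p v)), ?_, C (q v - p v)⁻¹ * (C (q v) - X v), ?_, ?_⟩
  · simp
  · simp
  · rw [← mul_add, sub_add_sub_comm, add_comm (X v), sub_add_eq_sub_sub, add_sub_right_comm,
      add_sub_cancel_right, ← C_sub, ← C_mul, inv_mul_cancel₀ hv', C_1]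

/-- Modulo such a `J`, every polynomial is congruent to its value at `p`. -/
lemma vanishingIdeal_le_of_forall_X_sub_mem {p : σ → ℂ} {J : Ideal (MvPolynomial σ ℂ)}
    (h : ∀ v, X v - C (p v) ∈ J) : vanishingIdeal ℂ {p} ≤ J := by
  have e : Ideal.Quotient.mk J = (Ideal.Quotient.mk J).comp (C.comp (eval p)) := by
    apply ringHom_ext
    · intro r; simp
    · intro v
      simpa using Ideal.Quotient.eq.2 (h v)
  intro f hf
  rw [mem_vanishingIdeal_singleton_iff] at hf
  rw [← Ideal.Quotient.eq_zero_iff_mem, e]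
  have : eval p f = 0 := hf
  simp [this]

lemma prod_sup_le {R ι : Type*} [CommRing R] (I : Ideal R) (s : Finset ι) (f : ι → Ideal R) :
    ∏ i ∈ s, (I ⊔ f i) ≤ I ⊔ ∏ i ∈ s, f i := by
  classical
  induction s using Finset.induction_on with
  | empty => simp
  | insert a s ha ih =>
    rw [Finset.prod_insert ha, Finset.prod_insert ha]
    refine (Ideal.mul_mono_right ih).trans ?_
    rw [Ideal.sup_mul]
    refine sup_le (Ideal.mul_le_left.trans le_sup_left) ?_
    rw [Ideal.mul_sup]
    exact sup_le (Ideal.mul_le_right.trans le_sup_left) le_sup_right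

variable [Finite σ]

/-- The condition `m ≤ I + m ^ 2` says that the cotangent space of the zero scheme at the point
vanishes. Multiplying over the finitely many points gives `J ≤ I + J ^ 2` for the vanishing ideal
`J`. Iteration gives `J ≤ I + J ^ (n + 1)` for all `n`, and a power of `J` lies in `I` by the
Nullstellensatz. -/
lemma eq_vanishingIdeal_of_unramified {I : Ideal (MvPolynomial σ ℂ)}
    (hfin : (zeroLocus ℂ I).Finite)
    (h : ∀ p ∈ zeroLocus ℂ I, vanishingIdeal ℂ {p} ≤ I ⊔ vanishingIdeal ℂ {p} ^ 2) :
    I = vanishingIdeal ℂ (zeroLocus ℂ I) := by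
  refine le_antisymm (le_vanishingIdeal_zeroLocus I) ?_
  set J := vanishingIdeal ℂ (zeroLocus ℂ I) with hJ
  clear_value J
  have hJle : J ≤ I ⊔ J ^ 2 := by
    have hprod : ∏ p ∈ hfin.toFinset, (vanishingIdeal ℂ {p} : Ideal (MvPolynomial σ ℂ)) = J := by
      rw [Ideal.prod_eq_iInf_of_pairwise_isCoprime fun p _ q _ hpq => isCoprime_vanishingIdeal hpq]
      ext f
      simp only [hJ, Submodule.mem_iInf, Set.Finite.mem_toFinset, Set.mem_singleton_iff, forall_eq,
        mem_vanishingIdeal_iff]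
    calc J = ∏ p ∈ hfin.toFinset, vanishingIdeal ℂ {p} := hprod.symm
      _ ≤ ∏ p ∈ hfin.toFinset, (I ⊔ vanishingIdeal ℂ {p} ^ 2) :=
        Finset.prod_le_prod' fun p hp => h p (by simpa using hp)
      _ ≤ I ⊔ ∏ p ∈ hfin.toFinset, vanishingIdeal ℂ {p} ^ 2 := prod_sup_le _ _ _
      _ = I ⊔ J ^ 2 := by rw [Finset.prod_pow, hprod]
  have hpow : ∀ n, J ≤ I ⊔ J ^ (n + 1) := by
    intro n
    induction n with
    | zero => simp
    | succ n ih =>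
      refine hJle.trans (sup_le le_sup_left ?_)
      rw [pow_two]
      refine (Ideal.mul_mono_right ih).trans ?_
      rw [Ideal.mul_sup, ← pow_succ']
      exact sup_le (Ideal.mul_le_right.trans le_sup_left) le_sup_right
  obtain ⟨n, hn⟩ := I.exists_radical_pow_le_of_fg (IsNoetherian.noetherian _)
  rw [← vanishingIdeal_zeroLocus_eq_radical (K := ℂ), ← hJ] at hn
  exact (hpow n).trans (sup_le le_rfl ((Ideal.pow_le_pow_right n.le_succ).trans hn))

/-- As `I` is the whole vanishing ideal, evaluation at the zeros is injective on the quotient; it is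
surjective by the Chinese remainder theorem. -/
lemma finrank_quotient_of_unramified {I : Ideal (MvPolynomial σ ℂ)}
    (hfin : (zeroLocus ℂ I).Finite)
    (h : ∀ p ∈ zeroLocus ℂ I, vanishingIdeal ℂ {p} ≤ I ⊔ vanishingIdeal ℂ {p} ^ 2) :
    Module.finrank ℂ (MvPolynomial σ ℂ ⧸ I) = (zeroLocus ℂ I).ncard := by
  have : Fintype (zeroLocus ℂ I) := hfin.fintype
  let ev : MvPolynomial σ ℂ →ₐ[ℂ] (zeroLocus ℂ I → ℂ) := AlgHom.pi fun p => aeval p.1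
  have hker : I = RingHom.ker ev := by
    refine (eq_vanishingIdeal_of_unramified hfin h).trans ?_
    ext f
    simp only [mem_vanishingIdeal_iff, RingHom.mem_ker, funext_iff, Subtype.forall]
    rfl
  have hsurj : Function.Surjective ev := by
    intro y
    obtain ⟨f, hf⟩ := Ideal.exists_forall_sub_mem_ideal 
      (I := fun p : zeroLocus ℂ I => (vanishingIdeal ℂ {p.1} : Ideal (MvPolynomial σ ℂ)))
      (fun p q hpq => isCoprime_vanishingIdeal (Subtype.coe_injective.ne hpq))
      (fun p => C (y p))
    refine ⟨f, funext fun p => ?_⟩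
    have := hf p
    rw [mem_vanishingIdeal_singleton_iff, map_sub, sub_eq_zero] at this
    simpa [ev] using this
  rw [((Ideal.quotientEquivAlgOfEq ℂ hker).trans
    (Ideal.quotientKerAlgEquivOfSurjective hsurj)).toLinearEquiv.finrank_eq,
    Module.finrank_fintype_fun_eq_card, ← Nat.card_eq_fintype_card, Nat.card_coe_set_eq]

end Unramified

/-! ### First order deformations of solutions -/

lemma IsTangent.submatrix {K : Type*} [Field K] {x z e : Matrix (Fin 5) (Fin 5) K}
    (h : IsTangent x z e) (s : Equiv.Perm (Fin 5)) :
    IsTangent (x.submatrix s s) (z.submatrix s s) (e.submatrix s s) where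
  symm i j := h.symm _ _
  diag i := h.diag _
  center i := by rw [← h.center (s i)]; exact Equiv.sum_comp s fun j => e (s i) j
  grad k i := by
    rw [Matrix.submatrix_apply, ← h.grad (s k) (s i)]
    exact Equiv.sum_comp s fun j => (e (s i) (s k) - e (s i) j) * z (s k) j +
      (x (s i) (s k) - x (s i) j) * (z (s k) j ^ 2 * e (s k) j)

lemma IsTangent.re {x z : Matrix (Fin 5) (Fin 5) ℝ} {e : Matrix (Fin 5) (Fin 5) ℂ}
    (h : IsTangent (toC x) (toC z) e) : IsTangent x z (e.map Complex.re) where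
  symm i j := congrArg Complex.re (h.symm i j)
  diag i := congrArg Complex.re (h.diag i)
  center i := by simpa using congrArg Complex.re (h.center i)
  grad k i := by
    have := congrArg Complex.re (h.grad k i)
    simp only [Complex.re_sum, toC, Matrix.map_apply, ← Complex.ofReal_sub, ← Complex.ofReal_pow,
      Complex.add_re, Complex.re_ofReal_mul, Complex.re_mul_ofReal, Complex.sub_re] at this
    simpa using this

lemma IsTangent.im {x z : Matrix (Fin 5) (Fin 5) ℝ} {e : Matrix (Fin 5) (Fin 5) ℂ}
    (h : IsTangent (toC x) (toC z) e) : IsTangent x z (e.map Complex.im) where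
  symm i j := congrArg Complex.im (h.symm i j)
  diag i := congrArg Complex.im (h.diag i)
  center i := by simpa using congrArg Complex.im (h.center i)
  grad k i := by
    have := congrArg Complex.im (h.grad k i)
    simp only [Complex.im_sum, toC, Matrix.map_apply, ← Complex.ofReal_sub, ← Complex.ofReal_pow,
      Complex.add_im, Complex.im_ofReal_mul, Complex.im_mul_ofReal, Complex.sub_im] at this
    simpa using this

lemma IsTangent.eq_zero_of_real {x z : Matrix (Fin 5) (Fin 5) ℝ}
    (hx : ∀ e, IsTangent x z e → e = 0) {e : Matrix (Fin 5) (Fin 5) ℂ}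
    (h : IsTangent (toC x) (toC z) e) : e = 0 := by
  have h1 := hx _ h.re
  have h2 := hx _ h.im
  ext i j
  exact Complex.ext (congrFun (congrFun h1 i) j) (congrFun (congrFun h2 i) j)

lemma IsTangent.eq_zero_of_mem_permOrbit {X Z x z : Matrix (Fin 5) (Fin 5) ℂ}
    (hX : ∀ e, IsTangent X Z e → e = 0) (hS : IsSolution X Z) (hx : x ∈ permOrbit X)
    (hz : IsSolution x z) {e : Matrix (Fin 5) (Fin 5) ℂ} (h : IsTangent x z e) : e = 0 := by
  obtain ⟨s, rfl⟩ := hx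
  obtain rfl : z = Z.submatrix s s := by
    rw [hz.eq_weights, (hS.submatrix s).eq_weights]
  have := h.submatrix s.symm
  simp only [Matrix.submatrix_submatrix, Equiv.self_comp_symm, Matrix.submatrix_id_id] at this
  have h0 := hX _ this
  ext i j
  simpa using congrFun (congrFun h0 (s i)) (s j)

/-- All complex solutions of the critical equations are nondegenerate. -/
lemma IsTangent.eq_zero {x z e : Matrix (Fin 5) (Fin 5) ℂ} (hx : IsSolution x z)
    (h : IsTangent x z e) : e = 0 := by
  rcases hx.mem_permOrbit with ho | ho | ho | ho
  · exact h.eq_zero_of_mem_permOrbit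
      (fun e => IsTangent.eq_zero_of_real fun e => IsTangent.simplex_eq_zero)
      (isSolution_simplex.map Complex.ofRealHom) ho hx
  · exact h.eq_zero_of_mem_permOrbit
      (fun e => IsTangent.eq_zero_of_real fun e => IsTangent.bipyramid_eq_zero)
      (isSolution_bipyramid.map Complex.ofRealHom) ho hx
  · exact h.eq_zero_of_mem_permOrbit
      (fun e => IsTangent.eq_zero_of_real fun e => IsTangent.pyramid_eq_zero)
      (isSolution_pyramid.map Complex.ofRealHom) ho hx
  · exact h.eq_zero_of_mem_permOrbit
      (fun e => IsTangent.eq_zero_of_real fun e => IsTangent.pentagon_eq_zero)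
      (isSolution_pentagon.map Complex.ofRealHom) ho hx

section Deformation

variable {R : Type*} [CommRing R] [Algebra ℂ R]

/-- Products of increments vanish, so the equations for `x` minus those for `X` are linear in the
increments. A `ℂ`-linear functional carries them to the tangent equations over `ℂ`. -/
lemma IsSolution.isTangent_of_deformation {X Z : Matrix (Fin 5) (Fin 5) ℂ}
    {x z : Matrix (Fin 5) (Fin 5) R} (hX : IsSolution X Z) (hx : IsSolution x z)
    (hsq : ∀ i j k l, (x i j - algebraMap ℂ R (X i j)) * (x k l - algebraMap ℂ R (X k l)) = 0)
    (φ : R →ₗ[ℂ] ℂ) : IsTangent X Z (Matrix.of fun i j => φ (x i j - algebraMap ℂ R (X i j))) := by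
  set ε : Matrix (Fin 5) (Fin 5) R := Matrix.of fun i j => x i j - algebraMap ℂ R (X i j) with hε
  have hxε : ∀ i j, x i j = algebraMap ℂ R (X i j) + ε i j := fun i j => by simp [hε]
  replace hsq : ∀ i j k l, ε i j * ε k l = 0 := hsq
  have hX' := hX.map (algebraMap ℂ R)
  -- First order expansion of `1 / (1 - x)`; no smallness of `z - Z` is assumed, since `z` is
  -- determined by `x`.
  have hz : ∀ i j, z i j = algebraMap ℂ R (Z i j) + algebraMap ℂ R (Z i j) ^ 2 * ε i j := by
    intro i j
    by_cases hij : i = j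
    · subst hij; simp [hx.z_diag, hX.z_diag]
    · have h1 := hx.aux i j hij
      have h2 := hX'.aux i j hij
      have h3 := hsq i j i j
      rw [hxε] at h1
      simp only [Matrix.map_apply] at h2
      generalize algebraMap ℂ R (Z i j) = Zc at *
      generalize algebraMap ℂ R (X i j) = Xc at *
      generalize ε i j = t at *
      linear_combination (Zc + Zc ^ 2 * t) * h1 - z i j * (1 + Zc * t) * h2 + z i j * Zc ^ 2 * h3
  refine ⟨fun i j => ?_, fun i => ?_, fun i => ?_, fun k i => ?_⟩
  · simp only [Matrix.of_apply]; rw [hx.x_symm, hX.x_symm]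
  · simp [hx.x_diag, hX.x_diag]
  · have h1 := hx.center i
    have h2 := hX'.center i
    simp only [Matrix.map_apply] at h2
    simp only [Matrix.of_apply, ← map_sum, Finset.sum_sub_distrib, h1, h2, sub_zero, map_zero]
  · have h1 := hx.grad k i
    have h2 := hX'.grad k i
    simp only [Matrix.map_apply] at h2
    have h3 : ∑ j, (Z k j • (ε i k - ε i j) + ((X i k - X i j) * Z k j ^ 2) • ε k j)
        = (4 : ℂ) • ε i k := by
      have e : ∀ j, Z k j • (ε i k - ε i j) + ((X i k - X i j) * Z k j ^ 2) • ε k j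
          = (x i k - x i j) * z k j
            - (algebraMap ℂ R (X i k) - algebraMap ℂ R (X i j)) * algebraMap ℂ R (Z k j) := by
        intro j
        rw [hz, hxε i k, hxε i j]
        simp only [Algebra.smul_def, map_mul, map_sub, map_pow]
        linear_combination algebraMap ℂ R (Z k j) ^ 2 * (hsq i j k j - hsq i k k j)
      simp only [e, Finset.sum_sub_distrib, h1]
      rw [h2, hxε, Algebra.smul_def, map_ofNat]
      ring
    have h4 := congrArg φ h3
    simp only [map_sum, map_add, map_smul, map_sub, smul_eq_mul] at h4
    change ∑ j, ((φ (ε i k) - φ (ε i j)) * Z k j + (X i k - X i j) * (Z k j ^ 2 * φ (ε k j)))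
      = 4 * φ (ε i k)
    rw [← h4]
    exact Finset.sum_congr rfl fun j _ => by ring

/-- First order deformations of a complex solution are trivial. -/
lemma IsSolution.eq_of_deformation {X Z : Matrix (Fin 5) (Fin 5) ℂ}
    {x z : Matrix (Fin 5) (Fin 5) R} (hX : IsSolution X Z) (hx : IsSolution x z)
    (hsq : ∀ i j k l, (x i j - algebraMap ℂ R (X i j)) * (x k l - algebraMap ℂ R (X k l)) = 0) :
    (∀ i j, x i j = algebraMap ℂ R (X i j)) ∧ ∀ i j, z i j = algebraMap ℂ R (Z i j) := by
  have h1 : ∀ i j, x i j = algebraMap ℂ R (X i j) := by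
    intro i j
    -- Linear functionals separate the elements of the `ℂ`-vector space `R`.
    rw [← sub_eq_zero, ← Module.forall_dual_apply_eq_zero_iff ℂ]
    intro φ
    exact congrFun (congrFun (IsTangent.eq_zero hX (hX.isTangent_of_deformation hx hsq φ)) i) j
  refine ⟨h1, fun i j => ?_⟩
  by_cases hij : i = j
  · subst hij; simp [hx.z_diag, hX.z_diag]
  · have h2 := hx.aux i j hij
    have h3 := (hX.map (algebraMap ℂ R)).aux i j hij
    simp only [Matrix.map_apply] at h3
    rw [h1] at h2
    linear_combination algebraMap ℂ R (Z i j) * h2 - z i j * h3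

end Deformation

/-! ### The critical ideal -/

lemma symMatrix_map {n : ℕ} {R S : Type*} (c : R) (x : Pair n → R) (f : R → S) :
    (symMatrix c x).map f = symMatrix (f c) (f ∘ x) := by
  ext i j
  simp only [symMatrix, Matrix.map_apply, Matrix.of_apply]
  split_ifs <;> rfl

lemma symMatrix_symm {n : ℕ} {R : Type*} (c : R) (x : Pair n → R) (i j : Fin n) :
    symMatrix c x i j = symMatrix c x j i := by
  simp only [symMatrix, Matrix.of_apply]
  rcases lt_trichotomy i j with h | h | h
  · simp [h, h.not_gt]
  · simp [h]
  · simp [h, h.not_gt]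

lemma symMatrix_diag {n : ℕ} {R : Type*} (c : R) (x : Pair n → R) (i : Fin n) :
    symMatrix c x i i = c := by
  simp [symMatrix]

lemma symMatrix_pair {n : ℕ} {R : Type*} (c : R) (x : Pair n → R) (p : Pair n) :
    symMatrix c x p.1.1 p.1.2 = x p := by
  simp [symMatrix, p.2]

/-- A ring homomorphism kills the critical ideal if and only if the images of the variables solve
the critical equations. -/
lemma criticalIdeal_le_ker_iff {S : Type*} [CommRing S] (f : MvPolynomial (Vars 5) ℚ →+* S) :
    criticalIdeal 5 ≤ RingHom.ker f ↔ IsSolution ((xVar 5).map f) ((zVar 5).map f) := by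
  have hcenter : ∀ i, f (centerPoly 5 i) = ∑ j, f (xVar 5 i j) := by
    intro i
    rw [← Finset.add_sum_erase _ _ (Finset.mem_univ i), xVar, symMatrix_diag]
    simp [centerPoly, xVar]
  have haux : ∀ i j, f (auxPoly 5 i j) = f (zVar 5 i j) * (1 - f (xVar 5 i j)) - 1 := by
    intro i j; simp [auxPoly]
  have hgrad : ∀ k i, f (gradPoly 5 k i)
      = ∑ j, (f (xVar 5 i k) - f (xVar 5 i j)) * f (zVar 5 k j) - 4 * f (xVar 5 i k) := by
    intro k i
    rw [← Finset.add_sum_erase _ _ (Finset.mem_univ k), zVar, symMatrix_diag]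
    simp [gradPoly, zVar]
    rw [map_ofNat]
    ring
  rw [criticalIdeal, Ideal.span_le]
  constructor
  · intro h
    have aux : ∀ i j, i ≠ j → f (zVar 5 i j) * (1 - f (xVar 5 i j)) = 1 := by
      intro i j hij
      have := h (Or.inl (Or.inr ⟨i, j, hij, rfl⟩))
      rw [SetLike.mem_coe, RingHom.mem_ker, haux, sub_eq_zero] at this
      exact this
    refine ⟨fun i j => ?_, fun i j => ?_, fun i => ?_, fun i => ?_, fun i => ?_, aux, fun k i => ?_⟩
    · exact congrArg f (symMatrix_symm _ _ i j)
    · exact congrArg f (symMatrix_symm _ _ i j)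
    · simp [xVar, symMatrix_diag]
    · simp [zVar, symMatrix_diag]
    · have := h (Or.inl (Or.inl ⟨i, rfl⟩))
      rwa [SetLike.mem_coe, RingHom.mem_ker, hcenter] at this
    -- The ideal has no generator for `k = i`; that equation says `∑_{j ≠ k} (1 - x k j) * z k j =
    -- 4` and follows from the four auxiliary equations.
    · by_cases hki : k = i
      · subst hki
        have hd : f (xVar 5 k k) = 1 := by simp [xVar, symMatrix_diag]
        simp only [Matrix.map_apply, hd]
        rw [← Finset.add_sum_erase _ _ (Finset.mem_univ k), hd,
          Finset.sum_congr rfl fun j hj => by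
            rw [mul_comm, aux k j (Finset.ne_of_mem_erase hj).symm]]
        simp
      · have := h (Or.inr ⟨k, i, hki, rfl⟩)
        rw [SetLike.mem_coe, RingHom.mem_ker, hgrad, sub_eq_zero] at this
        exact this
  · rintro h _ ((⟨i, rfl⟩ | ⟨i, j, hij, rfl⟩) | ⟨k, i, hki, rfl⟩)
    · rw [SetLike.mem_coe, RingHom.mem_ker, hcenter]
      exact h.center i
    · rw [SetLike.mem_coe, RingHom.mem_ker, haux, sub_eq_zero]
      exact h.aux i j hij
    · rw [SetLike.mem_coe, RingHom.mem_ker, hgrad, sub_eq_zero]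
      exact h.grad k i

/-- The matrix of the auxiliary coordinates of a complex point `(x, z)`. -/
def auxMatrix {n : ℕ} (p : Vars n → ℂ) : Matrix (Fin n) (Fin n) ℂ :=
  symMatrix 0 fun q => p (Sum.inr q)

lemma mem_solutions_iff {p : Vars 5 → ℂ} :
    p ∈ solutions 5 ↔ IsSolution (dotMatrix p) (auxMatrix p) := by
  have h := criticalIdeal_le_ker_iff (MvPolynomial.aeval p : MvPolynomial (Vars 5) ℚ →ₐ[ℚ] ℂ).toRingHom
  have hx : (xVar 5).map (MvPolynomial.aeval p : MvPolynomial (Vars 5) ℚ →ₐ[ℚ] ℂ).toRingHom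
      = dotMatrix p := by
    rw [xVar, symMatrix_map, dotMatrix]
    congr 1
    · simp
    · funext q; simp
  have hz : (zVar 5).map (MvPolynomial.aeval p : MvPolynomial (Vars 5) ℚ →ₐ[ℚ] ℂ).toRingHom
      = auxMatrix p := by
    rw [zVar, symMatrix_map, auxMatrix]
    congr 1
    funext q
    simp
  rw [hx, hz] at h
  exact h

lemma dotMatrix_injOn : Set.InjOn dotMatrix (solutions 5) := by
  intro p hp q hq h
  rw [mem_solutions_iff] at hp hq
  have hz : auxMatrix p = auxMatrix q := by rw [hp.eq_weights, hq.eq_weights, h]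
  funext v
  rcases v with v | v
  · have := congrFun (congrFun h v.1.1) v.1.2
    rwa [dotMatrix, dotMatrix, symMatrix_pair, symMatrix_pair] at this
  · have := congrFun (congrFun hz v.1.1) v.1.2
    rwa [auxMatrix, auxMatrix, symMatrix_pair, symMatrix_pair] at this

lemma eq_symMatrix {n : ℕ} {R : Type*} {c : R} {x : Matrix (Fin n) (Fin n) R}
    (hs : ∀ i j, x i j = x j i) (hd : ∀ i, x i i = c) :
    symMatrix c (fun q => x q.1.1 q.1.2) = x := by
  ext i j
  simp only [symMatrix, Matrix.of_apply]
  split_ifs with h1 h2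
  · rfl
  · exact hs j i
  · rw [le_antisymm (not_lt.1 h2) (not_lt.1 h1), hd]

lemma image_dotMatrix : dotMatrix '' solutions 5 = criticalOrbits := by
  ext x
  rw [← exists_isSolution_iff]
  constructor
  · rintro ⟨p, hp, rfl⟩
    exact ⟨_, mem_solutions_iff.1 hp⟩
  · rintro ⟨z, h⟩
    have hx : dotMatrix (Sum.elim (fun q => x q.1.1 q.1.2) (fun q => z q.1.1 q.1.2)) = x :=
      eq_symMatrix h.x_symm h.x_diag
    have hz : auxMatrix (Sum.elim (fun q => x q.1.1 q.1.2) (fun q => z q.1.1 q.1.2)) = z :=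
      eq_symMatrix h.z_symm h.z_diag
    refine ⟨_, mem_solutions_iff.2 ?_, hx⟩
    rwa [hx, hz]

lemma ncard_solutions : (solutions 5).ncard = 38 := by
  rw [← ncard_criticalOrbits, ← image_dotMatrix, dotMatrix_injOn.ncard_image]

lemma zeroLocus_criticalIdealC : MvPolynomial.zeroLocus ℂ (criticalIdealC 5) = solutions 5 := by
  ext p
  have e : ∀ f : MvPolynomial (Vars 5) ℚ,
      MvPolynomial.aeval p (MvPolynomial.map (algebraMap ℚ ℂ) f) = MvPolynomial.aeval p f := by
    intro f
    exact MvPolynomial.aeval_map_algebraMap ℂ p f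
  constructor
  · intro h f hf
    rw [← e]
    exact h _ (Ideal.mem_map_of_mem _ hf)
  · intro h f hf
    have : criticalIdealC 5 ≤ RingHom.ker (MvPolynomial.aeval p : MvPolynomial (Vars 5) ℂ →ₐ[ℂ] ℂ) := by
      rw [criticalIdealC, Ideal.map_le_iff_le_comap]
      intro g hg
      rw [Ideal.mem_comap, RingHom.mem_ker, e]
      exact h g hg
    exact this hf

/-- In the quotient by `I + m ^ 2` the classes of the variables solve the equations and differ from
the point `p` by elements of square zero. Rigidity of first order deformations makes them equal to
the coordinates of `p`. -/
lemma vanishingIdeal_le_criticalIdealC_sup {p : Vars 5 → ℂ} (hp : p ∈ solutions 5) :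
    MvPolynomial.vanishingIdeal ℂ {p} ≤ criticalIdealC 5 ⊔ MvPolynomial.vanishingIdeal ℂ {p} ^ 2 := by
  set m : Ideal (MvPolynomial (Vars 5) ℂ) := MvPolynomial.vanishingIdeal ℂ {p} with hm
  set J := criticalIdealC 5 ⊔ m ^ 2 with hJ
  let f : MvPolynomial (Vars 5) ℚ →+* MvPolynomial (Vars 5) ℂ ⧸ J :=
    (Ideal.Quotient.mk J).comp (MvPolynomial.map (algebraMap ℚ ℂ))
  have hsol : IsSolution ((xVar 5).map f) ((zVar 5).map f) := by
    rw [← criticalIdeal_le_ker_iff]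
    intro g hg
    rw [RingHom.mem_ker]
    exact Ideal.Quotient.eq_zero_iff_mem.2
      (Ideal.mem_sup_left (Ideal.mem_map_of_mem _ hg))
  have hX := mem_solutions_iff.1 hp
  have hfx : (xVar 5).map f = symMatrix 1 fun q => Ideal.Quotient.mk J (MvPolynomial.X (Sum.inl q)) := by
    rw [xVar, symMatrix_map]
    congr 1
    · simp
    · funext q; simp [f]
  have hfz : (zVar 5).map f = symMatrix 0 fun q => Ideal.Quotient.mk J (MvPolynomial.X (Sum.inr q)) := by
    rw [zVar, symMatrix_map]
    congr 1
    · simp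
    · funext q; simp [f]
  have halg : ∀ a : ℂ, algebraMap ℂ (MvPolynomial (Vars 5) ℂ ⧸ J) a
      = Ideal.Quotient.mk J (MvPolynomial.C a) := fun a => rfl
  have hmem : ∀ i j, ∃ g ∈ m, (xVar 5).map f i j - algebraMap ℂ (MvPolynomial (Vars 5) ℂ ⧸ J) (dotMatrix p i j)
      = Ideal.Quotient.mk J g := by
    have hlt : ∀ q : Pair 5, ∃ g ∈ m, (xVar 5).map f q.1.1 q.1.2
        - algebraMap ℂ (MvPolynomial (Vars 5) ℂ ⧸ J) (dotMatrix p q.1.1 q.1.2)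
        = Ideal.Quotient.mk J g := by
      intro q
      refine ⟨MvPolynomial.X (Sum.inl q) - MvPolynomial.C (p (Sum.inl q)), ?_, ?_⟩
      · rw [hm, MvPolynomial.mem_vanishingIdeal_singleton_iff]; simp
      · rw [hfx, dotMatrix, symMatrix_pair, symMatrix_pair, halg, map_sub]
    intro i j
    rcases lt_trichotomy i j with h | h | h
    · exact hlt ⟨(i, j), h⟩
    · subst h
      exact ⟨0, m.zero_mem, by rw [hsol.x_diag, hX.x_diag]; simp⟩
    · rw [hsol.x_symm, hX.x_symm]
      exact hlt ⟨(j, i), h⟩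
  obtain ⟨h1, h2⟩ := hX.eq_of_deformation hsol (fun i j k l => by
    obtain ⟨g, hg, e⟩ := hmem i j
    obtain ⟨g', hg', e'⟩ := hmem k l
    rw [e, e', ← map_mul, Ideal.Quotient.eq_zero_iff_mem]
    refine Ideal.mem_sup_right ?_
    rw [pow_two]
    exact Ideal.mul_mem_mul hg hg')
  apply vanishingIdeal_le_of_forall_X_sub_mem
  rintro (q | q)
  · have := h1 q.1.1 q.1.2
    rw [hfx, dotMatrix, symMatrix_pair, symMatrix_pair, halg] at this
    exact Ideal.Quotient.eq.1 this
  · have := h2 q.1.1 q.1.2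
    rw [hfz, auxMatrix, symMatrix_pair, symMatrix_pair, halg] at this
    exact Ideal.Quotient.eq.1 this

lemma finrank_quotient_criticalIdealC :
    Module.finrank ℂ (MvPolynomial (Vars 5) ℂ ⧸ criticalIdealC 5) = 38 := by
  have hfin : (solutions 5).Finite := Set.finite_of_ncard_ne_zero (by rw [ncard_solutions]; simp)
  rw [finrank_quotient_of_unramified, zeroLocus_criticalIdealC, ncard_solutions]
  · rwa [zeroLocus_criticalIdealC]
  · intro p hp
    rw [zeroLocus_criticalIdealC] at hp
    exact vanishingIdeal_le_criticalIdealC_sup hp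

/-! ### Critical configurations and the critical equations -/

section Gradient

variable {n d : ℕ}

/-- The partial gradient of the Lagrangian with respect to `w i`. -/
def partialGrad (lam : Fin n → ℝ) (w : Config n d) (i : Fin n) : EuclideanSpace ℝ (Fin d) :=
  -(∑ j ∈ {i}ᶜ, (2 / ‖w i - w j‖ ^ 2) • (w i - w j)) + (2 * lam i) • w i

/-- The derivative of the Lagrangian. -/
def lagrangianDeriv (lam : Fin n → ℝ) (w : Config n d) : Config n d →L[ℝ] ℝ :=
  ∑ i, (innerSL ℝ (partialGrad lam w i)).comp (ContinuousLinearMap.proj i)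

lemma lagrangianDeriv_apply (lam : Fin n → ℝ) (w v : Config n d) :
    lagrangianDeriv lam w v = ∑ i, inner ℝ (partialGrad lam w i) (v i) := by
  simp [lagrangianDeriv]

lemma hasStrictFDerivAt_norm_sq_apply (w : Config n d) (i : Fin n) :
    HasStrictFDerivAt (fun v : Config n d => ‖v i‖ ^ 2)
      ((2 : ℝ) • (innerSL ℝ (w i)).comp (ContinuousLinearMap.proj i)) w := by
  have h : HasStrictFDerivAt (fun v : Config n d => v i)
      (ContinuousLinearMap.proj i : Config n d →L[ℝ] _) w :=
    (ContinuousLinearMap.proj i : Config n d →L[ℝ] _).hasStrictFDerivAt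
  refine ((hasStrictFDerivAt_norm_sq (w i)).comp w h).congr_fderiv ?_
  ext v; simp

/-- Strict differentiability is the form required by the Lagrange multiplier theorem. -/
lemma hasStrictFDerivAt_lagrangian (lam : Fin n → ℝ) {w : Config n d}
    (hw : Function.Injective w) :
    HasStrictFDerivAt (lagrangian lam) (lagrangianDeriv lam w) w := by
  have hlog : ∀ i, ∀ j ∈ Finset.Ioi i, HasStrictFDerivAt
      (fun v : Config n d => Real.log (‖v i - v j‖ ^ 2))
      ((‖w i - w j‖ ^ 2)⁻¹ • ((2 : ℝ) • (innerSL ℝ (w i - w j)).comp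
        (ContinuousLinearMap.proj (R := ℝ) (φ := fun _ : Fin n => EuclideanSpace ℝ (Fin d)) i
          - ContinuousLinearMap.proj j))) w := by
    intro i j hij
    have hne : w i - w j ≠ 0 := sub_ne_zero.2 (hw.ne (Finset.mem_Ioi.1 hij).ne)
    have hp : ∀ i, HasStrictFDerivAt (fun v : Config n d => v i)
        (ContinuousLinearMap.proj i : Config n d →L[ℝ] _) w := fun i =>
      (ContinuousLinearMap.proj i : Config n d →L[ℝ] _).hasStrictFDerivAt
    have h2 : HasStrictFDerivAt (fun v : Config n d => ‖v i - v j‖ ^ 2) _ w :=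
      (hasStrictFDerivAt_norm_sq (w i - w j)).comp w ((hp i).fun_sub (hp j))
    refine (h2.log (pow_ne_zero 2 (norm_ne_zero_iff.2 hne))).congr_fderiv ?_
    ext v
    simp only [smul_apply, ContinuousLinearMap.comp_apply, smul_eq_mul, nsmul_eq_mul]
    norm_num
  have hsum := ((HasStrictFDerivAt.fun_sum fun i (_ : i ∈ Finset.univ) =>
    HasStrictFDerivAt.fun_sum (hlog i)).neg).add
    (HasStrictFDerivAt.fun_sum fun i (_ : i ∈ Finset.univ) =>
      ((hasStrictFDerivAt_norm_sq_apply w i).sub_const 1).const_mul (lam i))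
  refine hsum.congr_fderiv ?_
  ext v
  rw [lagrangianDeriv_apply]
  -- Each pair `i < j` contributes to the gradients at both `i` and `j`; this regroups the sum over
  -- ordered pairs.
  have hT := Finset.sum_sum_Ioi_add_eq_sum_sum_off_diag
    (fun j i : Fin n => 2 / ‖w i - w j‖ ^ 2 * inner ℝ (w i - w j) (v i))
  simp only [partialGrad, inner_add_left, inner_neg_left, sum_inner, real_inner_smul_left,
    Finset.sum_add_distrib, Finset.sum_neg_distrib]
  rw [← hT]
  simp only [add_apply, neg_apply, sum_apply, smul_apply, ContinuousLinearMap.comp_apply, sub_apply,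
    ContinuousLinearMap.proj_apply, innerSL_apply_apply, smul_eq_mul]
  congr 1
  · congr 1
    refine Finset.sum_congr rfl fun i _ => Finset.sum_congr rfl fun j _ => ?_
    rw [norm_sub_rev (w j) (w i), ← neg_sub (w i) (w j), inner_neg_left, inner_sub_right]
    ring
  · exact Finset.sum_congr rfl fun i _ => by ring

lemma hasFDerivAt_lagrangian_zero_iff (lam : Fin n → ℝ) {w : Config n d}
    (hw : Function.Injective w) :
    HasFDerivAt (lagrangian lam) (0 : Config n d →L[ℝ] ℝ) w ↔ ∀ i, partialGrad lam w i = 0 := by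
  have h := (hasStrictFDerivAt_lagrangian lam hw).hasFDerivAt
  constructor
  · intro h0 i
    have e := h.unique h0
    have := congrArg (fun L : Config n d →L[ℝ] ℝ => L (Pi.single i (partialGrad lam w i))) e
    simp only [lagrangianDeriv_apply, zero_apply] at this
    rw [Finset.sum_eq_single i (fun j _ hj => by simp [Pi.single_eq_of_ne hj]) (by simp)] at this
    simpa using this
  · intro h0
    convert h using 1
    ext v
    simp [lagrangianDeriv_apply, h0]

end Gradient

section FivePoints

variable {d : ℕ} {w : Config 5 d}

lemma norm_sub_sq_eq_gram (w : Config 5 d) (i j : Fin 5) :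
    ‖w i - w j‖ ^ 2 = Matrix.gram ℝ w i i + Matrix.gram ℝ w j j - 2 * Matrix.gram ℝ w i j := by
  rw [norm_sub_sq_real]
  simp only [Matrix.gram_apply, real_inner_self_eq_norm_sq]
  ring

lemma OnSphere.gram_diag (h : OnSphere w) (i : Fin 5) : Matrix.gram ℝ w i i = 1 := by
  simp [Matrix.gram_apply, h i]

lemma gram_symm (w : Config 5 d) (i j : Fin 5) : Matrix.gram ℝ w i j = Matrix.gram ℝ w j i := by
  simp [Matrix.gram_apply, real_inner_comm]

lemma OnSphere.gram_ne_one (h : OnSphere w) (hw : Function.Injective w) {i j : Fin 5}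
    (hij : i ≠ j) : 1 - Matrix.gram ℝ w i j ≠ 0 := by
  intro e
  have h1 := norm_sub_sq_eq_gram w i j
  rw [h.gram_diag, h.gram_diag] at h1
  have h2 : ‖w i - w j‖ ^ 2 = 0 := by rw [h1]; linarith
  have h3 : w i - w j = 0 := by simpa using h2
  exact hij (hw (sub_eq_zero.1 h3))

/-- On the unit sphere `‖w i - w j‖ ^ 2 = 2 * (1 - x i j)`. The term `j = i` may be added because
its difference vector is zero. -/
lemma OnSphere.partialGrad_eq (h : OnSphere w) (lam : Fin 5 → ℝ) (i : Fin 5) :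
    partialGrad lam w i =
      -(∑ j, weights (Matrix.gram ℝ w) i j • (w i - w j)) + (2 * lam i) • w i := by
  rw [partialGrad]
  congr 2
  rw [← Finset.sum_subset (Finset.subset_univ ({i}ᶜ : Finset (Fin 5)))]
  · refine Finset.sum_congr rfl fun j hj => ?_
    have hij : i ≠ j := by simpa [eq_comm] using hj
    congr 1
    rw [norm_sub_sq_eq_gram, h.gram_diag, h.gram_diag]
    simp only [weights, Matrix.of_apply, hij, if_false]
    rw [show (1 : ℝ) + 1 - 2 * Matrix.gram ℝ w i j = 2 * (1 - Matrix.gram ℝ w i j) by ring,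
      div_mul_eq_div_div, div_self (two_ne_zero), one_div]
  · intro j _ hj
    have : j = i := by simpa using hj
    simp [this]

lemma weights_symm {x : Matrix (Fin 5) (Fin 5) ℝ} (hx : ∀ i j, x i j = x j i) (i j : Fin 5) :
    weights x i j = weights x j i := by
  simp only [weights, Matrix.of_apply, hx i j, eq_comm]

lemma IsCritical.isSolution (h : IsCritical w) :
    IsSolution (Matrix.gram ℝ w) (weights (Matrix.gram ℝ w)) := by
  obtain ⟨hs, hi, lam, hlam⟩ := h
  rw [hasFDerivAt_lagrangian_zero_iff lam hi] at hlam
  set G := Matrix.gram ℝ w with hG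
  have hsymm : ∀ i j, weights G i j = weights G j i := weights_symm (gram_symm w)
  have haux : ∀ i j, i ≠ j → weights G i j * (1 - G i j) = 1 := by
    intro i j hij
    simp only [weights, Matrix.of_apply, hij, if_false]
    exact inv_mul_cancel₀ (hs.gram_ne_one hi hij)
  have hg : ∀ i, ∑ j, weights G i j • (w i - w j) = (2 * lam i) • w i := by
    intro i
    have := hlam i
    rw [hs.partialGrad_eq] at this
    exact (neg_add_eq_zero.1 this)
  have hinner : ∀ i k, ∑ j, weights G i j * (G k i - G k j) = 2 * lam i * G k i := by
    intro i k
    have := congrArg (fun v => inner ℝ (w k) v) (hg i)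
    simpa [inner_sum, real_inner_smul_right, inner_sub_right, hG, Matrix.gram_apply] using this
  -- Pairing the equation at `i` with `w i`: each of the four other points contributes `z i j * (1 -
  -- x i j) = 1`.
  have hlam2 : ∀ i, 2 * lam i = 4 := by
    intro i
    have := hinner i i
    have hd : G i i = 1 := hs.gram_diag i
    rw [hd, mul_one] at this
    rw [← this, ← Finset.add_sum_erase _ _ (Finset.mem_univ i), hd,
      Finset.sum_congr rfl fun j hj => haux i j (Finset.ne_of_mem_erase hj).symm]
    simp
  -- Summed over `i`, the pair forces cancel by antisymmetry, while the other side is four times the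
  -- sum of the points.
  have hcenter : ∑ i, w i = 0 := by
    have e : ∑ i, ∑ j, weights G i j • (w i - w j) = (4 : ℝ) • ∑ i, w i := by
      rw [Finset.smul_sum]
      exact Finset.sum_congr rfl fun i _ => by rw [hg, hlam2]
    have e' : ∑ i, ∑ j, weights G i j • (w i - w j) = -∑ i, ∑ j, weights G i j • (w i - w j) := by
      conv_lhs => rw [Finset.sum_comm]
      simp only [← Finset.sum_neg_distrib]
      refine Finset.sum_congr rfl fun i _ => Finset.sum_congr rfl fun j _ => ?_
      rw [← smul_neg, neg_sub, hsymm]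
    rw [eq_neg_iff_add_eq_zero, ← two_smul ℝ, e, smul_smul] at e'
    simpa using e'
  refine ⟨gram_symm w, hsymm, hs.gram_diag, fun i => by simp [weights], fun i => ?_, haux,
    fun k i => ?_⟩
  · have := congrArg (fun v => inner ℝ (w i) v) hcenter
    simpa [inner_sum, hG, Matrix.gram_apply] using this
  · have := hinner k i
    rw [hlam2] at this
    rw [← this]
    exact Finset.sum_congr rfl fun j _ => mul_comm _ _

lemma isCritical_of_isSolution {z : Matrix (Fin 5) (Fin 5) ℝ}
    (h : IsSolution (Matrix.gram ℝ w) z) : IsCritical w := by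
  obtain rfl := h.eq_weights
  set G := Matrix.gram ℝ w with hG
  have hs : OnSphere w := by
    intro i
    have := h.x_diag i
    rw [hG, Matrix.gram_apply, real_inner_self_eq_norm_sq] at this
    exact (pow_eq_one_iff_of_nonneg (norm_nonneg _) two_ne_zero).1 this
  have hi : Function.Injective w := by
    intro i j e
    by_contra hij
    have h1 := h.aux i j hij
    have h2 := h.x_diag i
    rw [hG, Matrix.gram_apply] at h1 h2
    rw [← e, h2] at h1
    simp at h1
  refine ⟨hs, hi, fun _ => 2, ?_⟩
  rw [hasFDerivAt_lagrangian_zero_iff _ hi]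
  intro i
  rw [hs.partialGrad_eq, neg_add_eq_zero]
  rw [← sub_eq_zero]
  set v := ∑ j, weights G i j • (w i - w j) - ((2 : ℝ) * 2) • w i with hv
  -- The residual gradient lies in the span of the points and is orthogonal to each of them, hence
  -- is zero.
  have hperp : ∀ k, inner ℝ v (w k) = 0 := by
    intro k
    have := h.grad i k
    rw [real_inner_comm, hv, inner_sub_right, inner_sum, real_inner_smul_right]
    simp only [real_inner_smul_right, inner_sub_right]
    simp only [hG, Matrix.gram_apply] at this ⊢
    rw [sub_eq_zero, show (2 : ℝ) * 2 = 4 by norm_num, ← this]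
    exact Finset.sum_congr rfl fun j _ => mul_comm _ _
  have : inner ℝ v v = 0 := by
    conv_lhs => rw [hv]
    rw [← hv, inner_sub_right, inner_sum]
    simp [real_inner_smul_right, inner_sub_right, hperp]
  exact inner_self_eq_zero.1 this

end FivePoints

/-! ### Classification of critical configurations -/

lemma toC_injective {n : ℕ} : Function.Injective (toC (n := n)) :=
  matrix_map_injective Complex.ofReal_injective

lemma toC_mem_permOrbit_iff {n : ℕ} {X Y : Matrix (Fin n) (Fin n) ℝ} :
    toC Y ∈ permOrbit (toC X) ↔ Y ∈ permOrbit X := by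
  rw [toC, toC, permOrbit_map]
  exact toC_injective.mem_set_image

theorem isCritical_iff {d : ℕ} (w : Config 5 d) :
    IsCritical w ↔ Matrix.gram ℝ w ∈ permOrbit simplex ∨ Matrix.gram ℝ w ∈ permOrbit bipyramid ∨
      Matrix.gram ℝ w ∈ permOrbit pyramid ∨ Matrix.gram ℝ w ∈ permOrbit pentagon := by
  constructor
  · intro h
    have hC := (h.isSolution.map Complex.ofRealHom).mem_permOrbit
    rw [show (Matrix.gram ℝ w).map Complex.ofRealHom = toC (Matrix.gram ℝ w) from rfl] at hC
    simpa only [toC_mem_permOrbit_iff] using hC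
  · have key : ∀ {X Z}, IsSolution X Z → Matrix.gram ℝ w ∈ permOrbit X → IsCritical w := by
      intro X Z hX hw
      obtain ⟨W, hW⟩ := isSolution_of_mem_permOrbit hX hw
      exact isCritical_of_isSolution hW
    rintro (h | h | h | h)
    · exact key isSolution_simplex h
    · exact key isSolution_bipyramid h
    · exact key isSolution_pyramid h
    · exact key isSolution_pentagon h

/-! ### Realizations and ranks -/

lemma mem_permOrbit_self {n : ℕ} {R : Type*} (X : Matrix (Fin n) (Fin n) R) : X ∈ permOrbit X :=
  ⟨1, rfl⟩

lemma rank_of_mem_permOrbit {n : ℕ} {X Y : Matrix (Fin n) (Fin n) ℝ} (h : Y ∈ permOrbit X) :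
    Y.rank = X.rank := by
  obtain ⟨s, rfl⟩ := h
  exact Matrix.rank_submatrix X s s

lemma rank_gram_le {d : ℕ} (w : Config 5 d) : (Matrix.gram ℝ w).rank ≤ d := by
  let A : Matrix (Fin d) (Fin 5) ℝ := Matrix.of fun k i => w i k
  have : Matrix.gram ℝ w = Aᵀ * A := by
    ext i j
    simp [Matrix.gram_apply, Matrix.mul_apply, A, PiLp.inner_apply, mul_comm]
  rw [this]
  exact (Matrix.rank_mul_le_right _ _).trans (Matrix.rank_le_height A)

lemma gram_apply_eq_sum {n d : ℕ} (w : Config n d) (i j : Fin n) :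
    Matrix.gram ℝ w i j = ∑ k, w i k * w j k := by
  simp [Matrix.gram_apply, PiLp.inner_apply, mul_comm]

/-- Configurations can be regarded as configurations in a larger space. -/
lemma exists_gram_eq_of_le {r d : ℕ} (h : r ≤ d) (w : Config 5 r) :
    ∃ v : Config 5 d, Matrix.gram ℝ v = Matrix.gram ℝ w := by
  obtain ⟨m, rfl⟩ := Nat.exists_eq_add_of_le h
  refine ⟨fun i => WithLp.toLp 2 (Fin.append (w i) (0 : Fin m → ℝ)), ?_⟩
  ext i j
  simp [Matrix.gram_apply, PiLp.inner_apply, Fin.sum_univ_add]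

lemma exists_gram_eq_simplex : ∃ w : Config 5 4, Matrix.gram ℝ w = simplex := by
  have h5 : (√5 : ℝ) ^ 2 = 5 := Real.sq_sqrt (by norm_num)
  -- Solves `a + 3 * b = -1 / 2` and `a ^ 2 + 3 * b ^ 2 = 1`: the other four vertices are permuted
  -- by the coordinate permutations fixing the first.
  let a : ℝ := (3 * √5 - 1) / 8
  let b : ℝ := -(1 + √5) / 8
  refine ⟨![!₂[1/2, 1/2, 1/2, 1/2], !₂[a, b, b, b], !₂[b, a, b, b], !₂[b, b, a, b],
    !₂[b, b, b, a]], ?_⟩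
  ext i j
  rw [gram_apply_eq_sum, Fin.sum_univ_four]
  fin_cases i <;> fin_cases j <;> simp [simplex, a, b] <;> linarith

lemma exists_gram_eq_bipyramid : ∃ w : Config 5 3, Matrix.gram ℝ w = bipyramid := by
  have h3 : (√3 : ℝ) ^ 2 = 3 := Real.sq_sqrt (by norm_num)
  refine ⟨![!₂[0, 0, 1], !₂[0, 0, -1], !₂[1, 0, 0], !₂[-1/2, √3 / 2, 0], !₂[-1/2, -√3 / 2, 0]], ?_⟩
  ext i j
  rw [gram_apply_eq_sum, Fin.sum_univ_three]
  fin_cases i <;> fin_cases j <;> simp [bipyramid] <;> linarith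

lemma exists_gram_eq_pyramid : ∃ w : Config 5 3, Matrix.gram ℝ w = pyramid := by
  have h15 : (√15 : ℝ) ^ 2 = 15 := Real.sq_sqrt (by norm_num)
  refine ⟨![!₂[0, 0, 1], !₂[√15 / 4, 0, -1/4], !₂[0, √15 / 4, -1/4], !₂[-√15 / 4, 0, -1/4],
    !₂[0, -√15 / 4, -1/4]], ?_⟩
  ext i j
  rw [gram_apply_eq_sum, Fin.sum_univ_three]
  fin_cases i <;> fin_cases j <;> simp [pyramid] <;> linarith

lemma exists_gram_eq_pentagon : ∃ w : Config 5 2, Matrix.gram ℝ w = pentagon := by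
  obtain ⟨ζ, hζ, hA, hB⟩ := exists_primitiveRoot_five
  have hn : ‖ζ‖ = 1 := hζ.norm'_eq_one (by norm_num)
  have hconj : ∀ k : ℕ, ζ ^ (4 * k) = (starRingEnd ℂ) (ζ ^ k) := by
    intro k
    have h1 : ζ ^ k * ζ ^ (4 * k) = 1 := by
      rw [← pow_add, show k + 4 * k = 5 * k by ring, pow_mul, hζ.pow_eq_one, one_pow]
    have h2 : ζ ^ k * (starRingEnd ℂ) (ζ ^ k) = 1 := by
      rw [Complex.mul_conj, Complex.normSq_eq_norm_sq]; simp [hn]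
    exact mul_left_cancel₀ (pow_ne_zero k (hζ.ne_zero (by norm_num))) (h1.trans h2.symm)
  refine ⟨fun k => !₂[(ζ ^ (k : ℕ)).re, (ζ ^ (k : ℕ)).im], ?_⟩
  ext i j
  apply Complex.ofReal_injective
  rw [pentagon_apply hζ.pow_eq_one hA hB, hconj, hconj, gram_apply_eq_sum, Fin.sum_univ_two]
  generalize ζ ^ (i : ℕ) = a
  generalize ζ ^ (j : ℕ) = b
  apply Complex.ext
  · simp
  · simp
    ring

lemma le_rank_of_det_ne_zero {m : ℕ} {X : Matrix (Fin 5) (Fin 5) ℝ} (f g : Fin m → Fin 5)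
    (h : (X.submatrix f g).det ≠ 0) : m ≤ X.rank := by
  have h1 := Matrix.rank_of_det_ne_zero h
  have h2 := Matrix.rank_submatrix_le X f g
  rw [Fintype.card_fin] at h1
  omega

lemma rank_simplex : simplex.rank = 4 := by
  obtain ⟨w, hw⟩ := exists_gram_eq_simplex
  refine le_antisymm (hw ▸ rank_gram_le w) (le_rank_of_det_ne_zero ![0, 1, 2, 3] ![0, 1, 2, 3] ?_)
  have e : simplex.submatrix ![0, 1, 2, 3] ![0, 1, 2, 3] = !![(1 : ℝ), -1/4, -1/4, -1/4;
      -1/4, 1, -1/4, -1/4; -1/4, -1/4, 1, -1/4; -1/4, -1/4, -1/4, 1] := by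
    ext i j; fin_cases i <;> fin_cases j <;> rfl
  rw [e, Matrix.det_succ_row_zero]
  simp [Fin.sum_univ_four, Matrix.det_fin_three, Fin.succAbove]
  norm_num

lemma rank_bipyramid : bipyramid.rank = 3 := by
  obtain ⟨w, hw⟩ := exists_gram_eq_bipyramid
  refine le_antisymm (hw ▸ rank_gram_le w) (le_rank_of_det_ne_zero ![0, 2, 3] ![0, 2, 3] ?_)
  rw [Matrix.det_fin_three]
  simp [bipyramid]
  norm_num

lemma rank_pyramid : pyramid.rank = 3 := by
  obtain ⟨w, hw⟩ := exists_gram_eq_pyramid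
  refine le_antisymm (hw ▸ rank_gram_le w) (le_rank_of_det_ne_zero ![0, 1, 2] ![0, 1, 2] ?_)
  rw [Matrix.det_fin_three]
  simp [pyramid]
  norm_num

lemma rank_pentagon : pentagon.rank = 2 := by
  obtain ⟨w, hw⟩ := exists_gram_eq_pentagon
  refine le_antisymm (hw ▸ rank_gram_le w) (le_rank_of_det_ne_zero ![0, 1] ![0, 1] ?_)
  rw [Matrix.det_fin_two]
  have h : cosA < 1 / 2 := by
    have : √5 < (3 : ℝ) := by rw [Real.sqrt_lt' (by norm_num)]; norm_num
    simp only [cosA]; linarith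
  have := cosA_sq
  simp [pentagon]
  intro h'
  nlinarith

lemma exists_isCritical_gram_eq_iff {r : ℕ} {X : Matrix (Fin 5) (Fin 5) ℝ} (hr : X.rank = r)
    (hX : ∃ w : Config 5 r, Matrix.gram ℝ w = X)
    (hc : ∀ (d : ℕ) (w : Config 5 d), Matrix.gram ℝ w = X → IsCritical w) (d : ℕ) :
    (∃ w : Config 5 d, IsCritical w ∧ Matrix.gram ℝ w = X) ↔ X.rank ≤ d := by
  constructor
  · rintro ⟨w, -, rfl⟩
    exact rank_gram_le w
  · intro h
    obtain ⟨w, hw⟩ := hX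
    obtain ⟨v, hv⟩ := exists_gram_eq_of_le (hr ▸ h) w
    exact ⟨v, hc d v (hv.trans hw), hv.trans hw⟩

/-! ### Energies -/

lemma energy_nonneg {n d : ℕ} (w : Config n d) : 0 ≤ energy w :=
  Finset.prod_nonneg fun _ _ => Finset.prod_nonneg fun _ _ => sq_nonneg _

/-- The product over `i < j` is not visibly symmetric, but its square is the product over ordered
pairs. -/
lemma energy_comp {n d : ℕ} (w : Config n d) (s : Equiv.Perm (Fin n)) :
    energy (w ∘ s) = energy w := by
  have hsq : ∀ v : Config n d, energy v ^ 2 = ∏ i, ∏ j ∈ {i}ᶜ, ‖v j - v i‖ ^ 2 := by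
    intro v
    rw [← Finset.prod_prod_Ioi_mul_eq_prod_prod_off_diag fun j i => ‖v j - v i‖ ^ 2, energy,
      ← Finset.prod_pow]
    refine Finset.prod_congr rfl fun i _ => ?_
    rw [← Finset.prod_pow]
    refine Finset.prod_congr rfl fun j _ => ?_
    rw [norm_sub_rev (v j), sq (‖v i - v j‖ ^ 2)]
  refine (pow_left_inj₀ (energy_nonneg _) (energy_nonneg _) two_ne_zero).1 ?_
  rw [hsq, hsq]
  refine Fintype.prod_equiv s _ _ fun i => ?_
  refine Finset.prod_equiv s (fun j => ?_) fun j _ => rfl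
  simp

lemma gram_comp {d : ℕ} (w : Config 5 d) (s : Equiv.Perm (Fin 5)) :
    Matrix.gram ℝ (w ∘ s) = (Matrix.gram ℝ w).submatrix s s := rfl

lemma energy_eq_prod {d : ℕ} {w : Config 5 d} {X : Matrix (Fin 5) (Fin 5) ℝ}
    (hX : ∀ i, X i i = 1) (h : Matrix.gram ℝ w ∈ permOrbit X) :
    energy w = 2 ^ 10 * ((1 - X 0 1) * (1 - X 0 2) * (1 - X 0 3) * (1 - X 0 4) * (1 - X 1 2) *
      (1 - X 1 3) * (1 - X 1 4) * (1 - X 2 3) * (1 - X 2 4) * (1 - X 3 4)) := by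
  obtain ⟨s, hs⟩ := h
  have hg : Matrix.gram ℝ (w ∘ s.symm) = X := by
    rw [gram_comp, ← hs]; ext i j; simp
  rw [← energy_comp w s.symm, energy]
  simp only [norm_sub_sq_eq_gram, hg, hX]
  have e0 : Finset.Ioi (0 : Fin 5) = {1, 2, 3, 4} := by decide
  have e1 : Finset.Ioi (1 : Fin 5) = {2, 3, 4} := by decide
  have e2 : Finset.Ioi (2 : Fin 5) = {3, 4} := by decide
  have e3 : Finset.Ioi (3 : Fin 5) = {4} := by decide
  have e4 : Finset.Ioi (4 : Fin 5) = ∅ := by decide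
  simp only [Fin.prod_univ_five, e0, e1, e2, e3, e4]
  simp
  ring

section

variable {d : ℕ} {w : Config 5 d}

lemma energy_simplex (h : Matrix.gram ℝ w ∈ permOrbit simplex) :
    energy w = 2 ^ 10 * (5 / 4) ^ 10 := by
  rw [energy_eq_prod isSolution_simplex.x_diag h]
  simp [simplex]; norm_num

lemma energy_bipyramid (h : Matrix.gram ℝ w ∈ permOrbit bipyramid) :
    energy w = 2 ^ 10 * (27 / 4) := by
  rw [energy_eq_prod isSolution_bipyramid.x_diag h]
  simp [bipyramid]; norm_num

lemma energy_pyramid (h : Matrix.gram ℝ w ∈ permOrbit pyramid) :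
    energy w = 2 ^ 10 * ((5 / 4) ^ 4 * (15 / 16) ^ 4 * (15 / 8) ^ 2) := by
  rw [energy_eq_prod isSolution_pyramid.x_diag h]
  simp [pyramid]; norm_num

lemma energy_pentagon (h : Matrix.gram ℝ w ∈ permOrbit pentagon) :
    energy w = 2 ^ 10 * (3125 / 1024) := by
  rw [energy_eq_prod isSolution_pentagon.x_diag h]
  have e : (1 - cosA) * (1 - cosB) = 5 / 4 := by
    linear_combination cosA_mul_cosB - cosA_add_cosB
  have e5 : ((1 - cosA) * (1 - cosB)) ^ 5 = 3125 / 1024 := by rw [e]; norm_num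
  simp [pentagon]
  linear_combination e5

end

/-! ### Maximizers -/

lemma continuous_energy {n d : ℕ} : Continuous (energy (n := n) (d := d)) := by
  unfold energy
  fun_prop

lemma exists_isFeketeMaximizer {n d : ℕ} (h : ∃ w : Config n d, OnSphere w) :
    ∃ w : Config n d, IsFeketeMaximizer w := by
  have hset : {w : Config n d | OnSphere w} = Set.univ.pi fun _ => Metric.sphere 0 1 := by
    ext w; simp [OnSphere]
  have hc : IsCompact {w : Config n d | OnSphere w} := by
    rw [hset]
    exact isCompact_univ_pi fun _ => isCompact_sphere 0 1
  obtain ⟨w, hw, hmax⟩ := hc.exists_isMaxOn h continuous_energy.continuousOn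
  exact ⟨w, hw, fun v hv => hmax hv⟩

lemma injective_of_energy_ne_zero {n d : ℕ} {w : Config n d} (h : energy w ≠ 0) :
    Function.Injective w := by
  have key : ∀ i j, i < j → w i ≠ w j := by
    intro i j hij e
    apply h
    refine Finset.prod_eq_zero (Finset.mem_univ i) (Finset.prod_eq_zero (Finset.mem_Ioi.2 hij) ?_)
    simp [e]
  intro i j e
  rcases lt_trichotomy i j with hij | hij | hij
  · exact absurd e (key i j hij)
  · exact hij
  · exact absurd e.symm (key j i hij)

lemma lagrangian_zero_eq {n d : ℕ} {w : Config n d} (h : energy w ≠ 0) :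
    lagrangian (fun _ => 0) w = -Real.log (energy w) := by
  have h1 : ∀ i ∈ Finset.univ, ∏ j ∈ Finset.Ioi i, ‖w i - w j‖ ^ 2 ≠ 0 :=
    Finset.prod_ne_zero_iff.1 h
  rw [energy, Real.log_prod h1]
  simp only [lagrangian, zero_mul, Finset.sum_const_zero, add_zero]
  congr 1
  refine Finset.sum_congr rfl fun i hi => ?_
  rw [Real.log_prod (Finset.prod_ne_zero_iff.1 (h1 i hi))]

/-- Maximizers of positive energy are critical. -/
lemma IsFeketeMaximizer.isCritical {n d : ℕ} {w : Config n d} (h : IsFeketeMaximizer w)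
    (hpos : 0 < energy w) : IsCritical w := by
  obtain ⟨hs, hmax⟩ := h
  have hi := injective_of_energy_ne_zero hpos.ne'
  refine ⟨hs, hi, ?_⟩
  -- Near `w` the energy stays positive, so maximizing it amounts to minimizing its negative
  -- logarithm, the Lagrangian with zero multipliers.
  have hloc : IsLocalExtrOn (lagrangian (fun _ => 0)) {v : Config n d | ∀ i, ‖v i‖ ^ 2 = ‖w i‖ ^ 2} w := by
    left
    have hev : ∀ᶠ v in nhds w, 0 < energy v :=
      continuous_energy.continuousAt.eventually (lt_mem_nhds hpos)
    refine Filter.eventually_inf_principal.2 (hev.mono fun v hv hvs => ?_)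
    rw [lagrangian_zero_eq hv.ne', lagrangian_zero_eq hpos.ne']
    refine neg_le_neg (Real.log_le_log hv (hmax v fun i => ?_))
    have := hvs i
    rw [hs i, one_pow] at this
    exact (pow_eq_one_iff_of_nonneg (norm_nonneg _) two_ne_zero).1 this
  obtain ⟨Λ, Λ₀, hne, heq⟩ := hloc.exists_multipliers_of_hasStrictFDerivAt
    (fun i => hasStrictFDerivAt_norm_sq_apply w i) (hasStrictFDerivAt_lagrangian _ hi)
  have hv : ∀ v : Config n d, ∑ i, Λ i * (2 * inner ℝ (w i) (v i))
      + Λ₀ * ∑ i, inner ℝ (partialGrad (fun _ => 0) w i) (v i) = 0 := by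
    intro v
    have := congrArg (fun L : Config n d →L[ℝ] ℝ => L v) heq
    simpa [lagrangianDeriv_apply] using this
  have hsingle : ∀ i u, Λ i * (2 * inner ℝ (w i) u)
      + Λ₀ * inner ℝ (partialGrad (fun _ => 0) w i) u = 0 := by
    intro i u
    have := hv (Pi.single i u)
    rw [Finset.sum_eq_single i (fun j _ hj => by simp [Pi.single_eq_of_ne hj]) (by simp),
      Finset.sum_eq_single i (fun j _ hj => by simp [Pi.single_eq_of_ne hj]) (by simp)] at this
    simpa using this
  -- The constraint gradients are independent: testing against `w i` isolates `2 * Λ i`.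
  have hΛ₀ : Λ₀ ≠ 0 := by
    rintro rfl
    apply hne
    ext i
    · have := hsingle i (w i)
      rw [real_inner_self_eq_norm_sq, hs i] at this
      simpa using this
    · rfl
  refine ⟨fun i => Λ i / Λ₀, ?_⟩
  rw [hasFDerivAt_lagrangian_zero_iff _ hi]
  intro i
  have e : partialGrad (fun i => Λ i / Λ₀) w i
      = partialGrad (fun _ => 0) w i + (2 * (Λ i / Λ₀)) • w i := by
    simp [partialGrad]
  refine ext_inner_right ℝ fun u => ?_
  rw [e, inner_add_left, real_inner_smul_left, inner_zero_left]
  have := hsingle i u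
  field_simp
  linear_combination this

/-- Criterion describing the optimal configurations and the maximizers. -/
lemma isOptimal_and_isFeketeMaximizer_iff {d : ℕ} {O : Set (Matrix (Fin 5) (Fin 5) ℝ)} {E : ℝ}
    (hE : 0 < E) (hO : ∀ w : Config 5 d, Matrix.gram ℝ w ∈ O → IsCritical w ∧ energy w = E)
    (hlt : ∀ w : Config 5 d, IsCritical w → Matrix.gram ℝ w ∈ O ∨ energy w < E)
    (hex : ∃ w : Config 5 d, Matrix.gram ℝ w ∈ O) (w : Config 5 d) :
    (IsOptimal w ↔ Matrix.gram ℝ w ∈ O) ∧ (IsFeketeMaximizer w ↔ Matrix.gram ℝ w ∈ O) := by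
  obtain ⟨v₀, hv₀⟩ := hex
  obtain ⟨hc₀, he₀⟩ := hO v₀ hv₀
  have hle : ∀ v : Config 5 d, IsCritical v → energy v ≤ E := fun v hv =>
    (hlt v hv).elim (fun h => (hO v h).2.le) le_of_lt
  have hcrit : ∀ v : Config 5 d, IsFeketeMaximizer v → IsCritical v := fun v hv =>
    hv.isCritical (hE.trans_le (he₀ ▸ hv.2 v₀ hc₀.1))
  -- A global maximizer exists and is critical, so the bound `E` passes from critical configurations
  -- to all configurations.
  obtain ⟨u, hu⟩ := exists_isFeketeMaximizer ⟨v₀, hc₀.1⟩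
  have hall : ∀ v : Config 5 d, OnSphere v → energy v ≤ E := fun v hv =>
    (hu.2 v hv).trans (hle u (hcrit u hu))
  refine ⟨⟨fun h => ?_, fun h => ⟨(hO w h).1, fun v hv => (hO w h).2 ▸ hle v hv⟩⟩,
    ⟨fun h => ?_, fun h => ⟨(hO w h).1.1, fun v hv => (hO w h).2 ▸ hall v hv⟩⟩⟩
  · exact (hlt w h.1).resolve_right (not_lt.2 (he₀ ▸ h.2 v₀ hc₀))
  · exact (hlt w (hcrit w h)).resolve_right (not_lt.2 (he₀ ▸ h.2 v₀ hc₀.1))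

/-! ### Optimal configurations on the circle, the 2-sphere and the 3-sphere -/

lemma rank_le_of_gram_mem {d : ℕ} {w : Config 5 d} {X : Matrix (Fin 5) (Fin 5) ℝ}
    (h : Matrix.gram ℝ w ∈ permOrbit X) : X.rank ≤ d :=
  rank_of_mem_permOrbit h ▸ rank_gram_le w

/-- Rank alone decides: the other three types do not fit in the plane. -/
theorem optimal_circle (w : Config 5 2) :
    (IsOptimal w ↔ Matrix.gram ℝ w ∈ permOrbit pentagon) ∧
      (IsFeketeMaximizer w ↔ Matrix.gram ℝ w ∈ permOrbit pentagon) := by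
  refine isOptimal_and_isFeketeMaximizer_iff (E := 2 ^ 10 * (3125 / 1024)) (by norm_num)
    (fun v hv => ⟨(isCritical_iff v).2 (.inr (.inr (.inr hv))), energy_pentagon hv⟩)
    (fun v hv => ?_) (exists_gram_eq_pentagon.imp fun v hv => hv ▸ mem_permOrbit_self _) w
  rcases (isCritical_iff v).1 hv with h | h | h | h
  · have := rank_simplex ▸ rank_le_of_gram_mem h
    omega
  · have := rank_bipyramid ▸ rank_le_of_gram_mem h
    omega
  · have := rank_pyramid ▸ rank_le_of_gram_mem h
    omega
  · exact .inl h

/-- Rank excludes the simplex; the bipyramid beats the square pyramid narrowly, 6.75 against about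
6.63 after division by `2 ^ 10`. -/
theorem optimal_twoSphere (w : Config 5 3) :
    (IsOptimal w ↔ Matrix.gram ℝ w ∈ permOrbit bipyramid) ∧
      (IsFeketeMaximizer w ↔ Matrix.gram ℝ w ∈ permOrbit bipyramid) := by
  refine isOptimal_and_isFeketeMaximizer_iff (E := 2 ^ 10 * (27 / 4)) (by norm_num)
    (fun v hv => ⟨(isCritical_iff v).2 (.inr (.inl hv)), energy_bipyramid hv⟩)
    (fun v hv => ?_) (exists_gram_eq_bipyramid.imp fun v hv => hv ▸ mem_permOrbit_self _) w
  rcases (isCritical_iff v).1 hv with h | h | h | h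
  · have := rank_simplex ▸ rank_le_of_gram_mem h
    omega
  · exact .inl h
  · exact .inr (by rw [energy_pyramid h]; norm_num)
  · exact .inr (by rw [energy_pentagon h]; norm_num)

theorem optimal_threeSphere (w : Config 5 4) :
    (IsOptimal w ↔ Matrix.gram ℝ w ∈ permOrbit simplex) ∧
      (IsFeketeMaximizer w ↔ Matrix.gram ℝ w ∈ permOrbit simplex) := by
  refine isOptimal_and_isFeketeMaximizer_iff (E := 2 ^ 10 * (5 / 4) ^ 10) (by norm_num)
    (fun v hv => ⟨(isCritical_iff v).2 (.inl hv), energy_simplex hv⟩)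
    (fun v hv => ?_) (exists_gram_eq_simplex.imp fun v hv => hv ▸ mem_permOrbit_self _) w
  rcases (isCritical_iff v).1 hv with h | h | h | h
  · exact .inl h
  · exact .inr (by rw [energy_bipyramid h]; norm_num)
  · exact .inr (by rw [energy_pyramid h]; norm_num)
  · exact .inr (by rw [energy_pentagon h]; norm_num)

theorem exists_isCritical_gram_eq_iff_rank_le {X : Matrix (Fin 5) (Fin 5) ℝ}
    (hX : X ∈ ({simplex, bipyramid, pyramid, pentagon} : Set (Matrix (Fin 5) (Fin 5) ℝ))) (d : ℕ) :
    (∃ w : Config 5 d, IsCritical w ∧ Matrix.gram ℝ w = X) ↔ X.rank ≤ d := by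
  rcases hX with rfl | rfl | rfl | rfl
  · exact exists_isCritical_gram_eq_iff rank_simplex exists_gram_eq_simplex
      (fun d w h => (isCritical_iff w).2 (.inl (h ▸ mem_permOrbit_self _))) d
  · exact exists_isCritical_gram_eq_iff rank_bipyramid exists_gram_eq_bipyramid
      (fun d w h => (isCritical_iff w).2 (.inr (.inl (h ▸ mem_permOrbit_self _)))) d
  · exact exists_isCritical_gram_eq_iff rank_pyramid exists_gram_eq_pyramid
      (fun d w h => (isCritical_iff w).2 (.inr (.inr (.inl (h ▸ mem_permOrbit_self _))))) d
  · exact exists_isCritical_gram_eq_iff rank_pentagon exists_gram_eq_pentagon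
      (fun d w h => (isCritical_iff w).2 (.inr (.inr (.inr (h ▸ mem_permOrbit_self _))))) d

end Fekete

end

/-! ### The full classification for five points -/

theorem mainTheorem2 :
    -- classification of the critical configurations of five points, in every dimension
    (∀ (d : ℕ) (w : Fekete.Config 5 d),
      Fekete.IsCritical w ↔
        Matrix.gram ℝ w ∈ Fekete.permOrbit Fekete.simplex ∨
        Matrix.gram ℝ w ∈ Fekete.permOrbit Fekete.bipyramid ∨
        Matrix.gram ℝ w ∈ Fekete.permOrbit Fekete.pyramid ∨
        Matrix.gram ℝ w ∈ Fekete.permOrbit Fekete.pentagon) ∧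
    -- ranks
    (Fekete.simplex.rank = 4 ∧ Fekete.bipyramid.rank = 3 ∧
      Fekete.pyramid.rank = 3 ∧ Fekete.pentagon.rank = 2) ∧
    -- each type occurs on the unit sphere of `ℝ^d` exactly when `d` is at least its rank
    (∀ X ∈ ({Fekete.simplex, Fekete.bipyramid, Fekete.pyramid, Fekete.pentagon} :
        Set (Matrix (Fin 5) (Fin 5) ℝ)), ∀ d : ℕ,
      (∃ w : Fekete.Config 5 d, Fekete.IsCritical w ∧ Matrix.gram ℝ w = X) ↔ X.rank ≤ d) ∧
    -- product energies
    (∀ (d : ℕ) (w : Fekete.Config 5 d),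
      (Matrix.gram ℝ w ∈ Fekete.permOrbit Fekete.simplex →
        Fekete.energy w = 2 ^ 10 * (5 / 4) ^ 10) ∧
      (Matrix.gram ℝ w ∈ Fekete.permOrbit Fekete.bipyramid →
        Fekete.energy w = 2 ^ 10 * (27 / 4)) ∧
      (Matrix.gram ℝ w ∈ Fekete.permOrbit Fekete.pyramid →
        Fekete.energy w = 2 ^ 10 * ((5 / 4) ^ 4 * (15 / 16) ^ 4 * (15 / 8) ^ 2)) ∧
      (Matrix.gram ℝ w ∈ Fekete.permOrbit Fekete.pentagon →
        Fekete.energy w = 2 ^ 10 * (3125 / 1024))) ∧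
    -- orbit sizes
    ((Fekete.permOrbit Fekete.simplex).ncard = 1 ∧
      (Fekete.permOrbit Fekete.bipyramid).ncard = 10 ∧
      (Fekete.permOrbit Fekete.pyramid).ncard = 15 ∧
      (Fekete.permOrbit Fekete.pentagon).ncard = 12) ∧
    -- the polynomial system has 38 complex solutions counted with multiplicity,
    -- and 38 distinct ones, whose dot product matrices are those of the four orbits
    (Module.finrank ℂ (MvPolynomial (Fekete.Vars 5) ℂ ⧸ Fekete.criticalIdealC 5) = 38 ∧
      (Fekete.solutions 5).ncard = 38 ∧
      Fekete.dotMatrix '' Fekete.solutions 5 =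
        Fekete.permOrbit (Fekete.toC Fekete.simplex) ∪
        Fekete.permOrbit (Fekete.toC Fekete.bipyramid) ∪
        Fekete.permOrbit (Fekete.toC Fekete.pyramid) ∪
        Fekete.permOrbit (Fekete.toC Fekete.pentagon)) ∧
    -- the optimal configurations on the circle, the 2-sphere and the 3-sphere
    ((∀ w : Fekete.Config 5 2,
        (Fekete.IsOptimal w ↔ Matrix.gram ℝ w ∈ Fekete.permOrbit Fekete.pentagon) ∧
        (Fekete.IsFeketeMaximizer w ↔ Matrix.gram ℝ w ∈ Fekete.permOrbit Fekete.pentagon)) ∧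
      (∀ w : Fekete.Config 5 3,
        (Fekete.IsOptimal w ↔ Matrix.gram ℝ w ∈ Fekete.permOrbit Fekete.bipyramid) ∧
        (Fekete.IsFeketeMaximizer w ↔ Matrix.gram ℝ w ∈ Fekete.permOrbit Fekete.bipyramid)) ∧
      (∀ w : Fekete.Config 5 4,
        (Fekete.IsOptimal w ↔ Matrix.gram ℝ w ∈ Fekete.permOrbit Fekete.simplex) ∧
        (Fekete.IsFeketeMaximizer w ↔ Matrix.gram ℝ w ∈ Fekete.permOrbit Fekete.simplex))) := by
  open Fekete in
  refine ⟨fun d w => isCritical_iff w,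
    ⟨rank_simplex, rank_bipyramid, rank_pyramid, rank_pentagon⟩,
    fun X hX d => exists_isCritical_gram_eq_iff_rank_le hX d,
    fun d w => ⟨energy_simplex, energy_bipyramid, energy_pyramid, energy_pentagon⟩,
    ⟨?_, ?_, ?_, ?_⟩, ⟨finrank_quotient_criticalIdealC, ncard_solutions, image_dotMatrix⟩,
    optimal_circle, optimal_twoSphere, optimal_threeSphere⟩
  · rw [Fekete.simplex_eq_map, Fekete.ncard_permOrbit_map, Fekete.card_orbitFinset_simplex]
  · rw [Fekete.bipyramid_eq_map, Fekete.ncard_permOrbit_map, Fekete.card_orbitFinset_bipyramid]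
  · rw [Fekete.pyramid_eq_map, Fekete.ncard_permOrbit_map, Fekete.card_orbitFinset_pyramid]
  · rw [Fekete.pentagon_eq_map, Fekete.ncard_permOrbit_map, Fekete.card_orbitFinset_pentagon]
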